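/- Let \(X\) be a Boolean locale, i.e. a locale whose frame of opens \(F\) is a Boolean lattice (every \(U\in F\) has a complement), and let \(\mathcal{C}\) be an \(\infty\)-category with all small limits. A presheaf \(\mathcal{F}\colon F^{\mathrm{op}}\to\mathcal{C}\) is a sheaf, i.e. for every \(U\in F\) and every downward closed subset \(S\subseteq F\) with \(\bigvee S=U\) the canonical cone exhibits \(\mathcal{F}(U)\) as the limit \(\varprojlim_{V\in S^{\mathrm{op}}}\mathcal{F}(V)\) in \(\mathcal{C}\), if and only if it carries disjoint joins to products, i.e. for every small family \((a_i)_{i\in I}\) in \(F\) with \(a_i\wedge a_j=\bot\) for all \(i\neq j\), the restriction morphisms exhibit \(\mathcal{F}\bigl(\bigvee_{i\in I}a_i\bigr)\) as the product \(\prod_{i\in I}\mathcal{F}(a_i)\) in \(\mathcal{C}\). (The case \(I=\emptyset\) says that \(\mathcal{F}(\bot)\) is final.) -/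

import Mathlib

open CategoryTheory Simplicial Opposite

universe u v w

namespace InftySheaf

/-- The set `X(L)` of `L`-shaped simplices of a simplicial set `X`, for a preorder `L` (below always
a finite linear order): a compatible choice of an `n`-simplex of `X` for each monotone map
`[n] → L`, that is, a map from the nerve of `L` to `X`. For `L = [n]` this is the set of
`n`-simplices of `X` (Yoneda), and for empty `L` it is a one-point set. -/
@[ext]
structure ShapedSimplex (X : SSet.{v}) (L : Type) [Preorder L] where
  val : ∀ n : SimplexCategory, (Fin (n.len + 1) →o L) → X.obj (op n)
  map_val : ∀ {m n : SimplexCategory} (g : m ⟶ n) (s : Fin (n.len + 1) →o L),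
    X.map g.op (val n s) = val m (s.comp g.toOrderHom)

namespace ShapedSimplex

variable {X Y : SSet.{v}} {L L' : Type} [Preorder L] [Preorder L']

/-- Restriction of an `L`-shaped simplex along a monotone map `L' → L`. -/
def restrict (x : ShapedSimplex X L) (φ : L' →o L) : ShapedSimplex X L' where
  val n s := x.val n (φ.comp s)
  map_val g s := x.map_val g (φ.comp s)

/-- The image of an `L`-shaped simplex under a map of simplicial sets. -/
def map (f : X ⟶ Y) (x : ShapedSimplex X L) : ShapedSimplex Y L where
  val n s := f.app (op n) (x.val n s)
  map_val g s := by
    rw [← x.map_val g s]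
    exact (ConcreteCategory.congr_hom (f.naturality g.op) (x.val _ s)).symm

/-- The vertex at `l ∈ L` of an `L`-shaped simplex. -/
def vertex (x : ShapedSimplex X L) (l : L) : X _⦋0⦌ :=
  x.val ⦋0⦌ (OrderHom.const _ l)

/-- The edge from `l` to `l'` of an `L`-shaped simplex, for `l ≤ l'`. -/
def edge (x : ShapedSimplex X L) {l l' : L} (h : l ≤ l') : X _⦋1⦌ :=
  x.val ⦋1⦌ ⟨![l, l'], by
    intro i j hij
    fin_cases i <;> fin_cases j
    · exact le_rfl
    · exact h
    · exact absurd hij (by decide)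
    · exact le_rfl⟩

lemma δ_one_edge (x : ShapedSimplex X L) {l l' : L} (h : l ≤ l') :
    X.δ 1 (x.edge h) = x.vertex l := by
  refine (x.map_val (SimplexCategory.δ 1) _).trans (congrArg (x.val ⦋0⦌) ?_)
  ext i
  fin_cases i
  rfl

lemma δ_zero_edge (x : ShapedSimplex X L) {l l' : L} (h : l ≤ l') :
    X.δ 0 (x.edge h) = x.vertex l' := by
  refine (x.map_val (SimplexCategory.δ 0) _).trans (congrArg (x.val ⦋0⦌) ?_)
  ext i
  fin_cases i
  rfl

/-- An `n`-simplex of `X` and a monotone map `L → [n]` give an `L`-shaped simplex. -/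
def ofSimplex {n : SimplexCategory} (x : X.obj (op n)) (φ : L →o Fin (n.len + 1)) :
    ShapedSimplex X L where
  val m s := X.map (Quiver.Hom.op (SimplexCategory.Hom.mk (φ.comp s) : m ⟶ n)) x
  map_val {m k} g s := by
    rw [← CategoryTheory.comp_apply, ← Functor.map_comp]
    rfl

/-- The unique simplex of empty shape. -/
def empty [IsEmpty L] : ShapedSimplex X L where
  val _ s := isEmptyElim (s 0)
  map_val _ s := isEmptyElim (s 0)

end ShapedSimplex

/-- The part of `[n]` on which a cut `[n] → {false < true}` takes the value `b`. -/
abbrev Part {n : SimplexCategory} (c : Fin (n.len + 1) →o Bool) (b : Bool) : Type :=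
  {i : Fin (n.len + 1) // c i = b}

/-- The monotone map between the parts induced by a map of the simplex category. -/
def partMap {m n : SimplexCategory} (g : m ⟶ n) (c : Fin (n.len + 1) →o Bool) (b : Bool) :
    Part (c.comp g.toOrderHom) b →o Part c b where
  toFun i := ⟨g.toOrderHom i.1, i.2⟩
  monotone' _ _ h := g.toOrderHom.monotone h

/-- An `n`-simplex of the join `A ⋆ K`: a cut of `[n]` into an initial and a final segment (either
may be empty), a simplex of `A` on the initial and a simplex of `K` on the final segment. -/
@[ext]
structure JoinSimplex (A K : SSet.{v}) (n : SimplexCategory) where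
  cut : Fin (n.len + 1) →o Bool
  left : ShapedSimplex A (Part cut false)
  right : ShapedSimplex K (Part cut true)

/-- The join `A ⋆ K` of simplicial sets. -/
def join (A K : SSet.{v}) : SSet.{v} where
  obj n := JoinSimplex A K n.unop
  map g := ↾fun x ↦
    { cut := x.cut.comp g.unop.toOrderHom
      left := x.left.restrict (partMap g.unop x.cut false)
      right := x.right.restrict (partMap g.unop x.cut true) }
  map_id _ := rfl
  map_comp _ _ := rfl

/-- The join is functorial in its first variable. -/
def joinMap {A B : SSet.{v}} (f : A ⟶ B) (K : SSet.{v}) : join A K ⟶ join B K where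
  app n := ↾fun x : JoinSimplex A K n.unop ↦
    (⟨x.cut, x.left.map f, x.right⟩ : JoinSimplex B K n.unop)
  naturality _ _ _ := rfl

/-- The inclusion `K → A ⋆ K`. -/
def joinInr (A K : SSet.{v}) : K ⟶ join A K where
  app n := ↾fun x ↦
    ({ cut := OrderHom.const _ true
       left :=
        haveI : IsEmpty (Part (n := n.unop) (OrderHom.const _ true) false) :=
          ⟨fun i ↦ Bool.noConfusion i.2⟩
        ShapedSimplex.empty
       right := ShapedSimplex.ofSimplex (n := n.unop) x (OrderHom.Subtype.val _) } :
      JoinSimplex A K n.unop)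
  naturality m n g := by
    ext x
    refine JoinSimplex.ext rfl (heq_of_eq ?_) (heq_of_eq ?_)
    · refine ShapedSimplex.ext ?_
      funext k s
      exact Bool.noConfusion (s 0).2
    · refine ShapedSimplex.ext ?_
      funext k s
      change K.map _ (K.map g x) = K.map _ x
      rw [← CategoryTheory.comp_apply, ← Functor.map_comp]
      rfl

/-- The left cone `Kᐊ = Δ⁰ ⋆ K`. -/
abbrev leftCone (K : SSet.{v}) : SSet.{v} := join Δ[0] K

/-- The last vertex `{n + 1} ⊆ ∂Δⁿ⁺¹`. -/
def boundaryLast (n : ℕ) : (Δ[0] : SSet.{v}) ⟶ (∂Δ[n + 1] : SSet.{v}) :=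
  SSet.const ⟨SSet.stdSimplex.obj₀Equiv.symm (Fin.last (n + 1)), by
    rw [SSet.boundary_obj_eq_univ 0 (n + 1)]
    trivial⟩

/-- A cone `q : Kᐊ → C` is a limit cone if it is a final object of the slice `C_{/p}`, where
`p = q|_K`. An `n`-simplex of `C_{/p}` is a map `Δⁿ ⋆ K → C` extending `p`, and a vertex is final iff
every map `∂Δⁿ⁺¹ → C_{/p}` whose last vertex it is extends to `Δⁿ⁺¹`; so the condition reads: every
map `∂Δⁿ⁺¹ ⋆ K → C` that restricts to `q` on `{n + 1} ⋆ K` extends to `Δⁿ⁺¹ ⋆ K`. -/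
def IsLimitCone {K C : SSet.{v}} (q : leftCone K ⟶ C) : Prop :=
  ∀ (n : ℕ) (f : join (∂Δ[n + 1] : SSet.{v}) K ⟶ C), joinMap (boundaryLast n) K ≫ f = q →
    ∃ g : join Δ[n + 1] K ⟶ C, joinMap (∂Δ[n + 1]).ι K ≫ g = f

/-- `C` has limits of all `u`-small diagrams. -/
def HasSmallLimits (C : SSet.{max u w}) : Prop :=
  ∀ (K : SSet.{u}) (p : SSet.uliftFunctor.{w, u}.obj K ⟶ C),
    ∃ q : leftCone (SSet.uliftFunctor.{w, u}.obj K) ⟶ C, joinInr _ _ ≫ q = p ∧ IsLimitCone q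

/-- The nerve of a category, as a simplicial set in a possibly larger universe. -/
abbrev nerve' (P : Type u) [Category.{u} P] : SSet.{max u w} :=
  SSet.uliftFunctor.{w, u}.obj (nerve P)

/-- The map on nerves induced by a functor. -/
abbrev nerveMap' {P Q : Type u} [Category.{u} P] [Category.{u} Q] (φ : P ⥤ Q) :
    nerve'.{u, w} P ⟶ nerve'.{u, w} Q :=
  SSet.uliftFunctor.{w, u}.map (nerveMap φ)

section Nerve

variable {Q : Type u} [Preorder Q]

/-- The object of `Q` corresponding to a vertex of the nerve. -/
def vertexObj (x : (nerve'.{u, w} Q) _⦋0⦌) : Q := (ULift.down x).obj 0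

/-- The map from a simplicial set to the nerve of a preorder with given values on vertices. -/
def toNerve (Z : SSet.{max u w}) (val : Z _⦋0⦌ → Q)
    (h : ∀ e : Z _⦋1⦌, val (Z.δ 1 e) ≤ val (Z.δ 0 e)) : Z ⟶ nerve'.{u, w} Q where
  app n := ↾fun z ↦ ULift.up (Monotone.functor
    (f := fun i : Fin (n.unop.len + 1) ↦ val (Z.map (SimplexCategory.const ⦋0⦌ n.unop i).op z)) (by
      intro i j hij
      have key := h (Z.map (SimplexCategory.mkOfLe (n := n.unop.len) i j hij).op z)
      simp only [SimplicialObject.δ, ← CategoryTheory.comp_apply, ← Functor.map_comp,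
        ← op_comp] at key
      convert key using 5 <;>
      · apply SimplexCategory.Hom.ext
        ext a
        fin_cases a
        rfl) : ComposableArrows Q n.unop.len)
  naturality m n g := by
    ext z
    refine congrArg ULift.up (nerve.ext_of_isThin (n := n) (funext fun i ↦ ?_))
    refine congrArg val ?_
    change Z.map (SimplexCategory.const ⦋0⦌ n.unop i).op (Z.map g z) = Z.map _ z
    rw [← CategoryTheory.comp_apply, ← Functor.map_comp]
    rfl

lemma vertexObj_le {Z : SSet.{max u w}} (p : Z ⟶ nerve'.{u, w} Q) (e : Z _⦋1⦌) :
    vertexObj (p.app _ (Z.δ 1 e)) ≤ vertexObj (p.app _ (Z.δ 0 e)) := by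
  rw [SSet.δ_naturality_apply, SSet.δ_naturality_apply]
  exact leOfHom ((ULift.down (p.app _ e)).map (homOfLE (Fin.zero_le 1)))

/-- The cone in the nerve of a preorder `Q` over a diagram `p : K → N(Q)` whose cone point is a
lower bound `b` of the objects in the diagram: `b` on the cone point, and `p` on `K`. -/
def coneOfLowerBound {K : SSet.{max u w}} (p : K ⟶ nerve'.{u, w} Q) (b : Q)
    (hb : ∀ k : K _⦋0⦌, b ≤ vertexObj (p.app _ k)) : leftCone K ⟶ nerve'.{u, w} Q :=
  toNerve _ (fun x : JoinSimplex Δ[0] K ⦋0⦌ ↦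
      if h : x.cut 0 = true then vertexObj (p.app _ (x.right.vertex ⟨0, h⟩)) else b) (by
    intro (e : JoinSimplex Δ[0] K ⦋1⦌)
    change (if h : e.cut 0 = true then vertexObj (p.app _ (e.right.vertex ⟨0, h⟩)) else b) ≤
      (if h : e.cut 1 = true then vertexObj (p.app _ (e.right.vertex ⟨1, h⟩)) else b)
    have h01 : e.cut 0 ≤ e.cut 1 := e.cut.monotone (Fin.zero_le 1)
    by_cases h0 : e.cut 0 = true
    · have h1 : e.cut 1 = true := by
        rw [h0] at h01
        exact top_le_iff.mp h01
      rw [dif_pos h0, dif_pos h1]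
      have hle : (⟨0, h0⟩ : Part e.cut true) ≤ ⟨1, h1⟩ := Fin.zero_le (1 : Fin 2)
      have := vertexObj_le p (e.right.edge hle)
      rwa [ShapedSimplex.δ_one_edge, ShapedSimplex.δ_zero_edge] at this
    · rw [dif_neg h0]
      split_ifs with h1
      · exact hb _
      · exact le_rfl)

end Nerve

section Presheaf

variable {X : Type u} [Order.Frame X] {C : SSet.{max u w}}

/-- A `C`-valued presheaf on the locale with frame of opens `X`: a functor `Xᵒᵖ → C`. Here the
opposite of the category `X` is presented as the order dual `Xᵒᵈ`. -/
abbrev Presheaf (X : Type u) [Order.Frame X] (C : SSet.{max u w}) : Type (max u w) :=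
  nerve'.{u, w} Xᵒᵈ ⟶ C

/-- The cone in `Xᵒᵖ` with cone point `b` over a diagram of opens contained in `b`. -/
def opensCone {P : Type u} [Category.{u} P] (φ : P ⥤ Xᵒᵈ) (b : X)
    (hb : ∀ k : P, OrderDual.ofDual (φ.obj k) ≤ b) :
    leftCone (nerve'.{u, w} P) ⟶ nerve'.{u, w} Xᵒᵈ :=
  coneOfLowerBound (nerveMap'.{u, w} φ) (OrderDual.toDual b)
    (fun k ↦ OrderDual.le_toDual.mp (hb ((ULift.down k).obj 0)))

/-- The inclusion `Sᵒᵖ → Xᵒᵖ` of a sieve (a downward closed set of opens). -/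
def sieveInclusion (S : LowerSet X) : (S : Set X)ᵒᵈ ⥤ Xᵒᵈ :=
  Monotone.functor (f := fun V ↦ OrderDual.toDual (OrderDual.ofDual V).1) (fun _ _ h ↦ h)

/-- A presheaf `F` is a sheaf if for every open `U` and every sieve `S` covering `U` (a downward
closed set of opens with join `U`), the canonical cone exhibits `F(U)` as the limit of the `F(V)`
over `V ∈ Sᵒᵖ`. -/
def IsSheaf (F : Presheaf.{u, w} X C) : Prop :=
  ∀ (U : X) (S : LowerSet X) (hS : IsLUB (S : Set X) U),
    IsLimitCone (opensCone.{u, w} (sieveInclusion S) U (fun V ↦ hS.1 (OrderDual.ofDual V).2) ≫ F)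

/-- A family of elements is (pairwise) disjoint if `a i ⊓ a j = ⊥` for `i ≠ j`. -/
def IsDisjointFamily {I : Type u} (a : I → X) : Prop :=
  ∀ i j, i ≠ j → a i ⊓ a j = ⊥

/-- `F` carries disjoint joins to products: for every small disjoint family `(a i)`, the
restrictions `F(⨆ i, a i) → F(a i)` exhibit `F(⨆ i, a i)` as the product of the `F(a i)`. -/
def CarriesDisjointJoinsToProducts (F : Presheaf.{u, w} X C) : Prop :=
  ∀ (I : Type u) (a : I → X), IsDisjointFamily a →
    IsLimitCone (opensCone.{u, w} (Discrete.functor (fun i ↦ OrderDual.toDual (a i))) (⨆ i, a i)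
      (fun i ↦ le_iSup a i.as) ≫ F)

end Presheaf

end InftySheaf

/-! Let F(⊥) be final, let (a_i) be a disjoint family, and let T be the sieve of opens contained in
some a_i. The product of the F(a_i) is then the limit of F over T (`isLim_familyHom_iff`): final
factors with a_i = ⊥ can be dropped; a nonzero V in T lies in exactly one a_i, so the nonzero part
of T splits into pieces with greatest elements a_i, which compute the limit; and adding ⊥ back to
the index changes nothing. For a sheaf, F(⊥) is final because the empty sieve covers ⊥, and the
sheaf condition for T gives the product condition.

Conversely, complements ensure that a maximal disjoint family inside a covering sieve S of U has
join U (`exists_pairwiseDisjoint_sSup_eq`). It generates a sieve T ⊆ S, and F(U) is the limit over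
T. For p in S the opens a_i ⊓ p are disjoint with join p and generate the part of T below p, so F(p)
is the limit over that part. Thus F on S is the pointwise right Kan extension of F on T, and both
have the same limit.

The two comparisons of limits used here are proved on chains. A simplex of Δ^N ⋆ N(R) is a chain in
the ordinal sum of [N] and R, and maps out of subcomplexes become `PartialNerveMap`s. Limits over R
and over a subset Q agree once maps extend from U₀ ⋆ R ∪ U ⋆ Q to U ⋆ R (`ExtendsAlong.isLim_iff`).
The extension attaches minimal missing chains one at a time (`exists_extension`), filling each by
the universal property of a limit (`extendsAlong_of_isLim`) or by an inner horn
(`extendsAlong_of_retraction`). The opposite of X is its order dual, so "above" there means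
"contained in". -/

namespace InftySheaf

/-! ### Maps out of subcomplexes of nerves: gluing and extension -/

/-- A map to `C` from the part of the nerve of `T` formed by the chains belonging to `Φ`. -/
structure PartialNerveMap {T : Type u} [Preorder T] (Φ : LowerSet (Set T)) (C : SSet.{v}) where
  val : ∀ (n : SimplexCategory) (s : Fin (n.len + 1) →o T), Set.range s ∈ Φ → C.obj (op n)
  map_val : ∀ {m n : SimplexCategory} (g : m ⟶ n) (s : Fin (n.len + 1) →o T)
    (h : Set.range s ∈ Φ) (h' : Set.range (s.comp g.toOrderHom) ∈ Φ),
    C.map g.op (val n s h) = val m (s.comp g.toOrderHom) h'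

lemma range_comp_mem {T A B : Type*} [Preorder T] [Preorder A] [Preorder B]
    {Φ : LowerSet (Set T)} {s : B →o T} (h : Set.range s ∈ Φ) (g : A →o B) :
    Set.range (s.comp g) ∈ Φ :=
  Φ.lower (Set.range_comp_subset_range g s) h

namespace PartialNerveMap

variable {T : Type u} {T' : Type w} [Preorder T] [Preorder T'] {C : SSet.{v}}

lemma val_congr {Φ : LowerSet (Set T)} (f : PartialNerveMap Φ C) {n : SimplexCategory}
    {s t : Fin (n.len + 1) →o T} (h : s = t) (hs : Set.range s ∈ Φ) :
    f.val n s hs = f.val n t (h ▸ hs) := by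
  subst h
  rfl

/-- Two partial maps agree where both are defined. -/
def Agree {Φ Ψ : LowerSet (Set T)} (f : PartialNerveMap Φ C) (g : PartialNerveMap Ψ C) : Prop :=
  ∀ (n : SimplexCategory) (s : Fin (n.len + 1) →o T) (h : Set.range s ∈ Φ)
    (h' : Set.range s ∈ Ψ), f.val n s h = g.val n s h'

/-- Pull back along a monotone map. -/
def comap {Φ : LowerSet (Set T)} {Φ' : LowerSet (Set T')} (f : PartialNerveMap Φ' C)
    (j : T →o T') (h : ∀ c ∈ Φ, j '' c ∈ Φ') : PartialNerveMap Φ C where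
  val n s hs := f.val n (j.comp s) (by
    have := h _ hs
    rwa [← Set.range_comp] at this)
  map_val g s _ _ := f.map_val g (j.comp s) _ _

/-- The image of a lower set of subsets under a map. -/
def _root_.LowerSet.imageSets (Ψ : LowerSet (Set T)) (j : T → T') : LowerSet (Set T') where
  carrier := {c | ∃ d ∈ Ψ, j '' d = c}
  lower' := by
    rintro _ c hc ⟨d, hd, rfl⟩
    refine ⟨d ∩ j ⁻¹' c, Ψ.lower Set.inter_subset_left hd, ?_⟩
    rw [Set.image_inter_preimage]
    exact Set.inter_eq_right.mpr hc

lemma exists_lift (j : T ↪o T') {n : SimplexCategory} (s : Fin (n.len + 1) →o T') {d : Set T}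
    (h : j '' d = Set.range s) :
    ∃ s₀ : Fin (n.len + 1) →o T, j.toOrderHom.comp s₀ = s ∧ Set.range s₀ = d := by
  have hex (i : Fin (n.len + 1)) : ∃ t ∈ d, j t = s i := by
    have : s i ∈ j '' d := h ▸ Set.mem_range_self i
    exact this
  choose t htd ht using hex
  have hc : j.toOrderHom.comp ⟨t, fun a b hab ↦ by
      rw [← j.le_iff_le, ht, ht]; exact s.monotone hab⟩ = s := by
    ext i; exact ht i
  refine ⟨_, hc, ?_⟩
  apply Set.Subset.antisymm
  · rintro _ ⟨i, rfl⟩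
    exact htd i
  · intro x hx
    have : j x ∈ Set.range s := h ▸ Set.mem_image_of_mem j hx
    obtain ⟨i, hi⟩ := this
    exact ⟨i, j.injective ((ht i).trans hi)⟩

/-- A partial map on `T'` and a partial map on `T` which agree on the overlap can be glued. -/
theorem exists_glue {Φ : LowerSet (Set T')} {Ψ : LowerSet (Set T)} (j : T ↪o T')
    (f : PartialNerveMap Φ C) (g : PartialNerveMap Ψ C)
    (hfg : ∀ (n : SimplexCategory) (s : Fin (n.len + 1) →o T) (hs : Set.range s ∈ Ψ)
      (hs' : Set.range (j.toOrderHom.comp s) ∈ Φ),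
      g.val n s hs = f.val n (j.toOrderHom.comp s) hs') :
    ∃ k : PartialNerveMap (Φ ⊔ Ψ.imageSets j) C, k.Agree f ∧
      ∀ (n : SimplexCategory) (s : Fin (n.len + 1) →o T) (hs : Set.range s ∈ Ψ)
        (hs' : Set.range (j.toOrderHom.comp s) ∈ Φ ⊔ Ψ.imageSets j),
        k.val n (j.toOrderHom.comp s) hs' = g.val n s hs := by
  have key (n : SimplexCategory) (s : Fin (n.len + 1) →o T')
      (hs : Set.range s ∈ Φ ⊔ Ψ.imageSets j) :
      ∃ y : C.obj (op n), (∀ h, y = f.val n s h) ∧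
        ∀ (s₀ : Fin (n.len + 1) →o T) (h : Set.range s₀ ∈ Ψ), j.toOrderHom.comp s₀ = s →
          y = g.val n s₀ h := by
    by_cases h : Set.range s ∈ Φ
    · refine ⟨f.val n s h, fun _ ↦ rfl, ?_⟩
      rintro s₀ h₀ rfl
      exact (hfg n s₀ h₀ h).symm
    · obtain ⟨d, hd, hds⟩ := hs.resolve_left h
      obtain ⟨s₀, rfl, rfl⟩ := exists_lift j s hds
      refine ⟨g.val n s₀ hd, fun h' ↦ absurd h' h, ?_⟩
      intro s₁ h₁ e
      refine val_congr g (OrderHom.ext _ _ (funext fun i ↦ j.injective ?_)) _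
      exact (DFunLike.congr_fun e i).symm
  choose y hy₁ hy₂ using key
  refine ⟨⟨y, ?_⟩, fun n s h h' ↦ hy₁ n s h h', fun n s hs hs' ↦ hy₂ n _ hs' s hs rfl⟩
  intro m n g' s h h'
  rcases id h with hs | ⟨d, hd, hds⟩
  · have hs : Set.range s ∈ Φ := hs
    rw [hy₁ n s h hs, hy₁ m _ h' (range_comp_mem hs _), f.map_val]
  · obtain ⟨s₀, rfl, rfl⟩ := exists_lift j s hds
    rw [hy₂ n _ h s₀ hd rfl, hy₂ m _ h' (s₀.comp g'.toOrderHom) (range_comp_mem hd _) rfl,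
      g.map_val]

/-- Chains whose proper faces belong to `Φ` but which do not belong to `Φ`. -/
structure IsMinimalMissing (Φ : LowerSet (Set T)) {n : ℕ} (s : Fin (n + 1) →o T) : Prop where
  notMem : Set.range s ∉ Φ
  injective : Function.Injective s
  mem_of_ssubset : ∀ c ⊂ Set.range s, c ∈ Φ

/-- A missing chain with the fewest vertices will do: a repeated vertex could be deleted without
changing the range, and proper faces have fewer vertices. The hypothesis on `∅` covers the faces of
a single vertex. -/
lemma exists_isMinimalMissing {T : Type u} [PartialOrder T] {Φ Φ₁ : LowerSet (Set T)}
    (hΦ : ∅ ∈ Φ)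
    (h : ∃ (n : ℕ) (s : Fin (n + 1) →o T), Set.range s ∈ Φ₁ ∧ Set.range s ∉ Φ) :
    ∃ (n : ℕ) (s : Fin (n + 1) →o T), Set.range s ∈ Φ₁ ∧ IsMinimalMissing Φ s := by
  classical
  obtain ⟨s, hs₁, hs⟩ := Nat.find_spec h
  have hmin (m : ℕ) (hm : m < Nat.find h) (t : Fin (m + 1) →o T) (ht : Set.range t ∈ Φ₁) :
      Set.range t ∈ Φ := by
    by_contra ht'
    exact Nat.find_min h hm ⟨t, ht, ht'⟩
  generalize Nat.find h = n at *
  have hface (i : Fin (n + 1)) (c : Set T) (hc : c ⊆ s '' {i}ᶜ) : c ∈ Φ := by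
    obtain _ | n := n
    · have : c = ∅ := by
        rw [Set.eq_empty_iff_forall_notMem]
        intro x hx
        obtain ⟨j, hj, -⟩ := hc hx
        exact hj (Subsingleton.elim (α := Fin 1) _ _)
      exact this ▸ hΦ
    · have hr : Set.range (s.comp (Fin.succAboveOrderEmb i).toOrderHom) = s '' {i}ᶜ := by
        change Set.range (s ∘ i.succAbove) = _
        rw [Set.range_comp, Fin.range_succAbove]
      refine Φ.lower (hc.trans hr.ge) (hmin n (Nat.lt_succ_self n) _ ?_)
      exact range_comp_mem hs₁ _
  refine ⟨n, s, hs₁, hs, ?_, ?_⟩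
  · intro a b hab
    by_contra hne
    refine hs (hface a _ ?_)
    rintro _ ⟨k, rfl⟩
    by_cases hk : k = a
    · exact ⟨b, fun h ↦ hne h.symm, by rw [hk, hab]⟩
    · exact ⟨k, hk, rfl⟩
  · intro c hc
    obtain ⟨_, ⟨i, rfl⟩, hi⟩ := Set.exists_of_ssubset hc
    refine hface i c ?_
    intro x hx
    obtain ⟨k, rfl⟩ := hc.1 hx
    exact ⟨k, fun hk ↦ hi (by rwa [← Set.mem_singleton_iff.mp hk]), rfl⟩

/-- Extension of partial maps one minimal missing chain at a time. -/
theorem exists_extension {T : Type u} [PartialOrder T] {Φ₀ : LowerSet (Set T)}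
    (Φ₁ : LowerSet (Set T)) (f₀ : PartialNerveMap Φ₀ C) (h₀ : ∅ ∈ Φ₀)
    (Rel : Set T → Set T → Prop) (hRel : ∀ c d, Rel c d → c ∈ Φ₀ → d ∈ Φ₀)
    (step : ∀ (Φ : LowerSet (Set T)) (f : PartialNerveMap Φ C), Φ₀ ≤ Φ → f.Agree f₀ →
      (∀ c d, Rel c d → c ∈ Φ → d ∈ Φ) → ∀ (n : ℕ) (s : Fin (n + 1) →o T), Set.range s ∈ Φ₁ →
      IsMinimalMissing Φ s → ∃ (Φ' : LowerSet (Set T)) (f' : PartialNerveMap Φ' C), Φ ≤ Φ' ∧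
        f'.Agree f ∧ Set.range s ∈ Φ' ∧ ∀ c d, Rel c d → c ∈ Φ' → d ∈ Φ') :
    ∃ f₁ : PartialNerveMap Φ₁ C, f₁.Agree f₀ := by
  -- Zorn's lemma on partial extensions. Closure under `Rel` is carried along as an invariant,
  -- because a single attaching step relies on it.
  let A := {x : Σ Φ : LowerSet (Set T), PartialNerveMap Φ C //
    Φ₀ ≤ x.1 ∧ x.2.Agree f₀ ∧ ∀ c d, Rel c d → c ∈ x.1 → d ∈ x.1}
  let r : A → A → Prop := fun x y ↦ x.1.1 ≤ y.1.1 ∧ y.1.2.Agree x.1.2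
  have hchain (S : Set A) (hS : IsChain r S) : ∃ ub, ∀ a ∈ S, r a ub := by
    obtain rfl | ⟨a₀, ha₀⟩ := S.eq_empty_or_nonempty
    · exact ⟨⟨⟨Φ₀, f₀⟩, le_rfl, fun _ _ _ _ ↦ rfl, hRel⟩, by simp⟩
    let Φ : LowerSet (Set T) := ⨆ a ∈ S, a.1.1
    have hmem (c : Set T) : c ∈ Φ ↔ ∃ a ∈ S, c ∈ a.1.1 := by simp [Φ]
    have hagree (a b : A) (ha : a ∈ S) (hb : b ∈ S) : a.1.2.Agree b.1.2 := by
      by_cases hab : a = b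
      · subst hab
        exact fun _ _ _ _ ↦ rfl
      rcases hS ha hb hab with h | h
      · exact fun n s h₁ h₂ ↦ (h.2 n s h₂ h₁).symm
      · exact h.2
    have key (n : SimplexCategory) (s : Fin (n.len + 1) →o T) (hs : Set.range s ∈ Φ) :
        ∃ y : C.obj (op n), ∀ a ∈ S, ∀ h, y = a.1.2.val n s h := by
      obtain ⟨a, ha, hsa⟩ := (hmem _).1 hs
      exact ⟨a.1.2.val n s hsa, fun b hb h ↦ hagree a b ha hb n s hsa h⟩
    choose y hy using key
    refine ⟨⟨⟨Φ, y, ?_⟩, ?_, ?_, ?_⟩, ?_⟩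
    · intro m n g s h h'
      obtain ⟨a, ha, hsa⟩ := (hmem _).1 h
      rw [hy n s h a ha hsa, hy m _ h' a ha (range_comp_mem hsa _), a.1.2.map_val]
    · exact a₀.2.1.trans fun c hc ↦ (hmem c).2 ⟨a₀, ha₀, hc⟩
    · intro n s h h'
      exact (hy n s h a₀ ha₀ (a₀.2.1 h')).trans (a₀.2.2.1 n s _ h')
    · intro c d hcd hc
      obtain ⟨a, ha, hca⟩ := (hmem _).1 hc
      exact (hmem _).2 ⟨a, ha, a.2.2.2 c d hcd hca⟩
    · intro a ha
      exact ⟨fun c hc ↦ (hmem c).2 ⟨a, ha, hc⟩, fun n s h h' ↦ hy n s h a ha h'⟩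
  obtain ⟨⟨⟨Φ, f⟩, hΦ₀, hf, hΦ⟩, hmax⟩ := exists_maximal_of_chains_bounded hchain
    (fun {a b c} hab hbc ↦ ⟨hab.1.trans hbc.1, fun n s h h' ↦
      (hbc.2 n s h (hab.1 h')).trans (hab.2 n s _ h')⟩)
  have hall (n : ℕ) (s : Fin (n + 1) →o T) (hs : Set.range s ∈ Φ₁) : Set.range s ∈ Φ := by
    by_contra hs'
    obtain ⟨m, t, ht, htm⟩ := exists_isMinimalMissing (hΦ₀ h₀) ⟨n, s, hs, hs'⟩
    obtain ⟨Φ', f', hle, hf', ht', hΦ'⟩ := step Φ f hΦ₀ hf hΦ m t ht htm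
    have := hmax ⟨⟨Φ', f'⟩, hΦ₀.trans hle, fun n s h h' ↦
      (hf' n s h (hΦ₀ h')).trans (hf n s _ h'), hΦ'⟩ ⟨hle, hf'⟩
    exact htm.notMem (this.1 ht')
  -- The maximal domain need not lie inside `Φ₁`, so the map is restricted at the end.
  exact ⟨⟨fun n s h ↦ f.val n s (hall n.len s h), fun g s h h' ↦ f.map_val g s _ _⟩,
    fun n s h h' ↦ hf n s _ h'⟩

end PartialNerveMap

/-! ### Joins as ordinal sums -/

open Sum (inlₗ inrₗ)

section JoinChains

@[elab_as_elim]
lemma sumLex_cases {L R : Type*} {p : L ⊕ₗ R → Prop} (x : L ⊕ₗ R) (hl : ∀ i, p (inlₗ i))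
    (hr : ∀ r, p (inrₗ r)) : p x := by
  rcases x with x | x
  · exact hl x
  · exact hr x

variable {L R R' : Type*} [Preorder L] [Preorder R] [Preorder R']

/-- The monotone map out of an ordinal sum given by monotone maps on the summands. -/
def sumLexElim {E : Type*} [Preorder E] (a : L →o E) (c : R →o E) (h : ∀ i r, a i ≤ c r) :
    L ⊕ₗ R →o E where
  toFun x := Sum.elim a c (ofLex x)
  monotone' := by
    rintro (x | x) (y | y) hxy
    · exact a.monotone (Sum.Lex.inl_le_inl_iff.1 hxy)
    · exact h x y
    · exact absurd hxy Sum.Lex.not_inr_le_inl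
    · exact c.monotone (Sum.Lex.inr_le_inr_iff.1 hxy)

/-- The ordinal sum with an order embedding of the right summand. -/
def sumLexMapRight (L : Type*) [Preorder L] (e : R ↪o R') : L ⊕ₗ R ↪o L ⊕ₗ R' where
  toFun x := toLex (Sum.map id e (ofLex x))
  inj' := by
    rintro (x | x) (y | y) h
    · exact congrArg inlₗ (Sum.inl_injective h)
    · exact absurd h Sum.inl_ne_inr
    · exact absurd h Sum.inr_ne_inl
    · exact congrArg inrₗ (e.injective (Sum.inr_injective h))
  map_rel_iff' := by
    rintro (x | x) (y | y)
    · exact Sum.Lex.inl_le_inl_iff.trans Sum.Lex.inl_le_inl_iff.symm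
    · exact iff_of_true (Sum.Lex.inl_le_inr _ _) (Sum.Lex.inl_le_inr _ _)
    · exact iff_of_false Sum.Lex.not_inr_le_inl Sum.Lex.not_inr_le_inl
    · exact (Sum.Lex.inr_le_inr_iff.trans e.le_iff_le).trans Sum.Lex.inr_le_inr_iff.symm

@[simp] lemma sumLexMapRight_inl (e : R ↪o R') (i : L) :
    sumLexMapRight L e (inlₗ i) = inlₗ i := rfl

@[simp] lemma sumLexMapRight_inr (e : R ↪o R') (r : R) :
    sumLexMapRight L e (inrₗ r) = inrₗ (e r) := rfl

/-- The sets of elements of `L ⊕ₗ R` whose part in `L` belongs to `U`. -/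
def joinChains (U : LowerSet (Set L)) (R : Type*) : LowerSet (Set (L ⊕ₗ R)) where
  carrier := {c | inlₗ ⁻¹' c ∈ U}
  lower' _ _ h hc := U.lower (Set.preimage_mono h) hc

lemma mem_joinChains {L R : Type*} {U : LowerSet (Set L)} {c : Set (L ⊕ₗ R)} :
    c ∈ joinChains U R ↔ inlₗ ⁻¹' c ∈ U := Iff.rfl

lemma preimage_inl_image_sumLexMapRight (e : R ↪o R') (c : Set (L ⊕ₗ R)) :
    inlₗ ⁻¹' (sumLexMapRight L e '' c) = inlₗ ⁻¹' c := by
  ext i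
  constructor
  · rintro ⟨x, hx, hxi⟩
    have : x = inlₗ i := (sumLexMapRight L e).injective hxi
    subst this
    exact hx
  · exact fun h ↦ ⟨inlₗ i, h, rfl⟩

lemma image_sumLexMapRight_mem (e : R ↪o R') (U : LowerSet (Set L)) (c : Set (L ⊕ₗ R))
    (hc : c ∈ joinChains U R) : sumLexMapRight L e '' c ∈ joinChains U R' := by
  rwa [mem_joinChains, preimage_inl_image_sumLexMapRight]

lemma range_sumLexMapRight_comp_mem {A : Type*} [Preorder A] (e : R ↪o R') {U : LowerSet (Set L)}
    {s : A →o L ⊕ₗ R} (hs : Set.range s ∈ joinChains U R) :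
    Set.range ((sumLexMapRight L e).toOrderHom.comp s) ∈ joinChains U R' := by
  have := image_sumLexMapRight_mem e U _ hs
  rwa [← Set.range_comp] at this

lemma mem_of_range_sumLexMapRight_comp_mem {A : Type*} [Preorder A] (e : R ↪o R')
    {U : LowerSet (Set L)} {s : A →o L ⊕ₗ R}
    (hs : Set.range ((sumLexMapRight L e).toOrderHom.comp s) ∈ joinChains U R') :
    Set.range s ∈ joinChains U R := by
  rw [mem_joinChains, ← preimage_inl_image_sumLexMapRight e, ← Set.range_comp]
  exact hs

/-- The proper subsets. -/
def properSubsets (L : Type*) : LowerSet (Set L) where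
  carrier := {c | c ≠ Set.univ}
  lower' := fun _ _ h hc hb ↦ hc (Set.univ_subset_iff.1 (hb ▸ h))

end JoinChains

/-! ### Limits in terms of chains, and their dependence on the indexing poset -/

section IsLim

variable {E : Type u} [Preorder E] {C : SSet.{v}}
  {R : Type w} [PartialOrder R] {R' : Type*} [PartialOrder R']

/-- The monotone map from an ordinal sum to `E` which is constant on the left summand. -/
def coneHom (L : Type*) [Preorder L] (φ : R →o E) (b : E) (hb : ∀ r, b ≤ φ r) : L ⊕ₗ R →o E :=
  sumLexElim (OrderHom.const _ b) φ (fun _ r ↦ hb r)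

/-- The restriction of `D` along `coneHom`, on the chains with left part in `U`. -/
def conePartialMap (D : PartialNerveMap (⊤ : LowerSet (Set E)) C) (φ : R →o E) (b : E)
    (hb : ∀ r, b ≤ φ r) {L : Type*} [Preorder L] (U : LowerSet (Set L)) :
    PartialNerveMap (joinChains U R) C :=
  D.comap (coneHom L φ b hb) (fun _ _ ↦ trivial)

/-- The condition that `D b` is the limit of the diagram `D ∘ φ`, expressed with partial maps. -/
def IsLim (D : PartialNerveMap (⊤ : LowerSet (Set E)) C) (φ : R →o E) (b : E)
    (hb : ∀ r, b ≤ φ r) : Prop :=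
  ∀ (n : ℕ) (f : PartialNerveMap (joinChains (properSubsets (Fin (n + 2))) R) C),
    f.Agree (conePartialMap D φ b hb (LowerSet.Iic {Fin.last (n + 1)})) →
    ∃ g : PartialNerveMap (joinChains (⊤ : LowerSet (Set (Fin (n + 2)))) R) C, g.Agree f

/-- Partial maps to `C` on `L ⊕ₗ R` which are given by `D` on `R` can be extended once they
have been extended over `L ⊕ₗ Q`. -/
def ExtendsAlong (D : PartialNerveMap (⊤ : LowerSet (Set E)) C) (φ : R →o E) (b : E)
    (hb : ∀ r, b ≤ φ r) (Q : Set R) : Prop :=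
  ∀ (N : ℕ) (U₀ U : LowerSet (Set (Fin (N + 1)))), ∅ ∈ U₀ → U₀ ≤ U →
    ∀ (f : PartialNerveMap (joinChains U₀ R) C) (g : PartialNerveMap (joinChains U Q) C),
    f.Agree (conePartialMap D φ b hb (LowerSet.Iic (∅ : Set (Fin (N + 1))))) →
    (∀ n s hs hs', g.val n s hs =
      f.val n ((sumLexMapRight _ (OrderEmbedding.subtype (· ∈ Q))).toOrderHom.comp s) hs') →
    ∃ k : PartialNerveMap (joinChains U R) C, k.Agree f ∧ ∀ n s hs hs', k.val n
      ((sumLexMapRight _ (OrderEmbedding.subtype (· ∈ Q))).toOrderHom.comp s) hs' = g.val n s hs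

variable {D : PartialNerveMap (⊤ : LowerSet (Set E)) C}

theorem IsLim.of_orderIso {φ : R →o E} {b : E} {hb : ∀ r, b ≤ φ r} (h : IsLim D φ b hb)
    (e : R ≃o R') (φ' : R' →o E) (hφ : ∀ r, φ' (e r) = φ r) (hb' : ∀ r, b ≤ φ' r) :
    IsLim D φ' b hb' := by
  intro n f hf
  let j := sumLexMapRight (Fin (n + 2)) e.toOrderEmbedding
  let j' := sumLexMapRight (Fin (n + 2)) e.symm.toOrderEmbedding
  have hjj' (x) : j (j' x) = x := by
    induction x using sumLex_cases <;> simp [j, j']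
  obtain ⟨g, hg⟩ := h n (f.comap j.toOrderHom (image_sumLexMapRight_mem _ _)) (by
    intro m s hs hs'
    refine (hf m (j.toOrderHom.comp s) _ ?_).trans (D.val_congr ?_ _)
    · exact range_sumLexMapRight_comp_mem _ hs'
    · ext i
      change coneHom _ φ' b hb' (j (s i)) = coneHom _ φ b hb (s i)
      induction s i using sumLex_cases with
      | hl i => rfl
      | hr r => exact hφ r)
  refine ⟨g.comap j'.toOrderHom (fun _ _ ↦ trivial), ?_⟩
  intro m s hs hs'
  refine (hg m (j'.toOrderHom.comp s) trivial ?_).trans (f.val_congr ?_ _)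
  · exact range_sumLexMapRight_comp_mem _ hs'
  · ext i
    exact hjj' (s i)

lemma coneHom_comp_sumLexMapRight {φ : R →o E} {b : E} {hb : ∀ r, b ≤ φ r} (Q : Set R)
    (L : Type*) [Preorder L] :
    (coneHom L φ b hb).comp (sumLexMapRight _ (OrderEmbedding.subtype (· ∈ Q))).toOrderHom =
      coneHom L (φ.comp (OrderHom.Subtype.val (· ∈ Q))) b (fun r ↦ hb r) := by
  ext x
  induction x using sumLex_cases <;> rfl

lemma singleton_last_mem_properSubsets (n : ℕ) :
    ({Fin.last (n + 1)} : Set (Fin (n + 2))) ∈ properSubsets (Fin (n + 2)) := by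
  intro h
  have : (0 : Fin (n + 2)) ∈ ({Fin.last (n + 1)} : Set (Fin (n + 2))) := h ▸ Set.mem_univ _
  exact absurd (Set.mem_singleton_iff.1 this) (Fin.last_pos (n := n)).ne

/-- Both directions move a boundary problem between `Q` and `R`. From `R` to `Q`, the problem over
`Q` is enlarged to one over `R`, solved there and restricted. From `Q` to `R`, the restricted
problem is solved over `Q`, and the solution is extended together with the given boundary data. -/
theorem ExtendsAlong.isLim_iff {φ : R →o E} {b : E} {hb : ∀ r, b ≤ φ r} {Q : Set R}
    (h : ExtendsAlong D φ b hb Q) :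
    IsLim D φ b hb ↔ IsLim D (φ.comp (OrderHom.Subtype.val (· ∈ Q))) b (fun r ↦ hb r) := by
  constructor
  · intro hlim n g hg
    have hlast : LowerSet.Iic {Fin.last (n + 1)} ≤ properSubsets (Fin (n + 2)) :=
      LowerSet.Iic_le.2 (singleton_last_mem_properSubsets n)
    -- With `U₀` the last vertex, the extension to the boundary joined with `R` is forced to be the
    -- given cone on that vertex, as the limit property over `R` requires.
    obtain ⟨f, hf, hfg⟩ := h (n + 1) (LowerSet.Iic {Fin.last (n + 1)}) (properSubsets _)
      (Set.empty_subset _) hlast (conePartialMap D φ b hb _) g (fun _ _ _ _ ↦ rfl) (by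
        intro m s hs hs'
        refine (hg m s hs ?_).trans (D.val_congr ?_ _)
        · exact mem_of_range_sumLexMapRight_comp_mem _ hs'
        · rw [← coneHom_comp_sumLexMapRight]
          rfl)
    obtain ⟨k, hk⟩ := hlim n f hf
    refine ⟨k.comap (sumLexMapRight _ (OrderEmbedding.subtype (· ∈ Q))).toOrderHom
      (fun _ _ ↦ trivial), fun m s hs hs' ↦ ?_⟩
    exact (hk m _ _ (range_sumLexMapRight_comp_mem _ hs')).trans (hfg _ _ hs' _)
  · intro hlim n f hf
    obtain ⟨g, hg⟩ := hlim n (f.comap (sumLexMapRight _ (OrderEmbedding.subtype (· ∈ Q))).toOrderHom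
      (image_sumLexMapRight_mem _ _)) (by
        intro m s hs hs'
        refine (hf m _ _ (range_sumLexMapRight_comp_mem _ hs')).trans (D.val_congr ?_ _)
        rw [← coneHom_comp_sumLexMapRight]
        rfl)
    obtain ⟨k, hk, -⟩ := h (n + 1) (properSubsets _) ⊤ (fun h ↦ Set.empty_ne_univ h) le_top f g
      (fun m s hs hs' ↦ hf m s hs
        (hs'.trans (Set.empty_subset _)))
      (fun m s hs hs' ↦ hg m s hs (mem_of_range_sumLexMapRight_comp_mem _ hs'))
    exact ⟨k, hk⟩

end IsLim

/-! ### Extension along a subset from pointwise limits -/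

lemma mem_imageSets_subtype {L R : Type*} [Preorder L] [Preorder R] {Q : Set R}
    {U : LowerSet (Set L)} {c : Set (L ⊕ₗ R)} :
    c ∈ (joinChains U Q).imageSets (sumLexMapRight L (OrderEmbedding.subtype (· ∈ Q))) ↔
      inlₗ ⁻¹' c ∈ U ∧ inrₗ ⁻¹' c ⊆ Q := by
  constructor
  · rintro ⟨d, hd, rfl⟩
    refine ⟨image_sumLexMapRight_mem _ _ _ hd, ?_⟩
    rintro r ⟨x, -, hx⟩
    induction x using sumLex_cases with
    | hl i => exact absurd hx Sum.inl_ne_inr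
    | hr q => exact (Sum.inr_injective hx : (q : R) = r) ▸ q.2
  · rintro ⟨h₁, h₂⟩
    have hc : sumLexMapRight L (OrderEmbedding.subtype (· ∈ Q)) ''
        (sumLexMapRight L (OrderEmbedding.subtype (· ∈ Q)) ⁻¹' c) = c := by
      rw [Set.image_preimage_eq_iff]
      intro x hx
      induction x using sumLex_cases with
      | hl i => exact ⟨inlₗ i, rfl⟩
      | hr q => exact ⟨inrₗ ⟨q, h₂ hx⟩, rfl⟩
    exact ⟨_, h₁, hc⟩

section

variable {E : Type u} [Preorder E] {C : SSet.{v}} {R : Type w} [PartialOrder R]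
  {D : PartialNerveMap (⊤ : LowerSet (Set E)) C} {φ : R →o E} {b : E} {hb : ∀ r, b ≤ φ r}

/-- The general form of extension along `Q`: attach the minimal missing chains one by one. -/
theorem ExtendsAlong.of_step {Q : Set R}
    (Rel : ∀ N : ℕ, Set (Fin (N + 1) ⊕ₗ R) → Set (Fin (N + 1) ⊕ₗ R) → Prop)
    (hRel : ∀ N c d, Rel N c d → inlₗ ⁻¹' d ⊆ inlₗ ⁻¹' c ∧ (inrₗ ⁻¹' c ⊆ Q → inrₗ ⁻¹' d ⊆ Q))
    (step : ∀ (N : ℕ) (U : LowerSet (Set (Fin (N + 1))))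
      (Φ : LowerSet (Set (Fin (N + 1) ⊕ₗ R))) (f : PartialNerveMap Φ C),
      (∀ c, inlₗ ⁻¹' c = ∅ → c ∈ Φ) →
      (∀ c, inlₗ ⁻¹' c ∈ U → inrₗ ⁻¹' c ⊆ Q → c ∈ Φ) →
      f.Agree (conePartialMap D φ b hb (LowerSet.Iic (∅ : Set (Fin (N + 1))))) →
      (∀ c d, Rel N c d → c ∈ Φ → d ∈ Φ) →
      ∀ (n : ℕ) (s : Fin (n + 1) →o Fin (N + 1) ⊕ₗ R), inlₗ ⁻¹' Set.range s ∈ U →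
      PartialNerveMap.IsMinimalMissing Φ s →
      ∃ (Φ' : LowerSet (Set (Fin (N + 1) ⊕ₗ R))) (f' : PartialNerveMap Φ' C), Φ ≤ Φ' ∧
        f'.Agree f ∧ Set.range s ∈ Φ' ∧ ∀ c d, Rel N c d → c ∈ Φ' → d ∈ Φ') :
    ExtendsAlong D φ b hb Q := by
  intro N U₀ U hU₀ hU f g hf hfg
  let j := sumLexMapRight (Fin (N + 1)) (OrderEmbedding.subtype (· ∈ Q))
  obtain ⟨f₀, hf₀, hg₀⟩ := PartialNerveMap.exists_glue j f g hfg
  have hempty (c : Set (Fin (N + 1) ⊕ₗ R)) (hc : inlₗ ⁻¹' c = ∅) :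
      c ∈ joinChains U₀ R ⊔ (joinChains U Q).imageSets j := by
    left
    change inlₗ ⁻¹' c ∈ U₀
    rwa [hc]
  obtain ⟨k, hk⟩ := PartialNerveMap.exists_extension (joinChains U R) f₀
    (hempty ∅ rfl) (Rel N) (by
      rintro c d hcd (hc | hc)
      · exact Or.inl (U₀.lower (hRel N c d hcd).1 hc)
      · have hc := mem_imageSets_subtype.1 hc
        exact Or.inr (mem_imageSets_subtype.2
          ⟨U.lower (hRel N c d hcd).1 hc.1, (hRel N c d hcd).2 hc.2⟩)) (by
      intro Φ f' hΦ hf' hgood n s hs hmin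
      refine step N U Φ f' (fun c hc ↦ hΦ (hempty c hc))
        (fun c h₁ h₂ ↦ hΦ (Or.inr (mem_imageSets_subtype.2 ⟨h₁, h₂⟩))) ?_ hgood n s hs hmin
      intro m t ht ht'
      have ht₀ : Set.range t ∈ joinChains U₀ R := U₀.lower ht' hU₀
      exact ((hf' m t ht (Or.inl ht₀)).trans (hf₀ m t _ ht₀)).trans (hf m t _ ht'))
  refine ⟨k, fun n s h h' ↦ (hk n s h (Or.inl h')).trans (hf₀ n s _ h'), ?_⟩
  intro n s hs hs'
  have hs'' : Set.range (j.toOrderHom.comp s) ∈ joinChains U₀ R ⊔ (joinChains U Q).imageSets j :=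
    Or.inr ⟨_, hs, (Set.range_comp _ _).symm⟩
  exact (hk n _ hs' hs'').trans (hg₀ n s hs hs'')

lemma exists_last_notMem {L : Type*} [Preorder L] {Q : Set R} {n : ℕ}
    (s : Fin (n + 1) →o L ⊕ₗ R) (u : Set (Fin (n + 1))) (hu : ¬ inrₗ ⁻¹' (s '' u) ⊆ Q) :
    ∃ i ∈ u, ∃ p ∉ Q, s i = inrₗ p ∧
      ∀ i' ∈ u, i < i' → ∃ q ∈ Q, p ≤ q ∧ s i' = inrₗ q := by
  have hne : {i | i ∈ u ∧ ∃ p ∉ Q, s i = inrₗ p}.Nonempty := by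
    obtain ⟨p, ⟨i, hi, hip⟩, hp⟩ := Set.not_subset.1 hu
    exact ⟨i, hi, p, hp, hip⟩
  obtain ⟨i, ⟨hi, p, hp, hip⟩, hmax⟩ :=
    (Set.toFinite {i | i ∈ u ∧ ∃ p ∉ Q, s i = inrₗ p}).exists_maximal hne
  refine ⟨i, hi, p, hp, hip, fun i' hi' hlt ↦ ?_⟩
  have hle := s.monotone hlt.le
  rw [hip] at hle
  generalize hx : s i' = x at hle
  induction x using sumLex_cases with
  | hl a => exact absurd hle Sum.Lex.not_inr_le_inl
  | hr q =>
    refine ⟨q, ?_, Sum.Lex.inr_le_inr_iff.1 hle, rfl⟩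
    by_contra hq
    exact hlt.not_ge (hmax ⟨hi', q, hq, hx⟩ hlt.le)

/-- If the restriction of `D ∘ φ` to `R` is pointwise a right Kan extension of its restriction
to `Q`, then maps extend along `Q`. -/
theorem extendsAlong_of_isLim (Q : Set R)
    (hlim : ∀ p ∉ Q, IsLim D (φ.comp (OrderHom.Subtype.val (· ∈ {q | q ∈ Q ∧ p ≤ q})))
      (φ p) (fun r ↦ φ.monotone r.2.2)) :
    ExtendsAlong D φ b hb Q := by
  -- The invariant: a chain with top element `p ∉ Q` that is already attached may be enlarged by any
  -- elements of `Q` above `p`. Whenever such a chain is filled, its whole join with `Q_{≥ p}` is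
  -- filled with it.
  refine ExtendsAlong.of_step (fun N c d ↦ ∃ p ∉ Q, inrₗ p ∈ c ∧ (∀ x ∈ c, x ≤ inrₗ p) ∧
    d ⊆ c ∪ inrₗ '' {q | q ∈ Q ∧ p ≤ q}) ?_ ?_
  · rintro N c d ⟨p, hp, hpc, -, hd⟩
    refine ⟨?_, fun h ↦ absurd (h hpc) hp⟩
    intro i hi
    rcases hd hi with h | ⟨q, -, h⟩
    · exact h
    · exact absurd h Sum.inr_ne_inl
  intro N U Φ f hempty hQ hf hgood n s hs hmin
  have hbad : ¬ inrₗ ⁻¹' (s '' Set.univ) ⊆ Q := by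
    rw [Set.image_univ]
    exact fun h ↦ hmin.notMem (hQ _ hs h)
  have hss (u : Set (Fin (n + 1))) (hu : u ≠ Set.univ) : s '' u ∈ Φ := by
    refine hmin.mem_of_ssubset _ ?_
    rw [← Set.image_univ]
    exact hmin.injective.image_strictMono (Set.ssubset_univ_iff.2 hu)
  -- a chain with the tail of a proper face added belongs to `Φ`
  have htail (u : Set (Fin (n + 1))) (i : Fin (n + 1)) (hi : i ∈ u) (p : R) (hp : p ∉ Q)
      (hip : s i = inrₗ p) (hne : u ∩ Set.Iic i ≠ Set.univ)
      (hafter : ∀ i' ∈ u, i < i' → ∃ q ∈ Q, p ≤ q ∧ s i' = inrₗ q) :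
      s '' u ∪ inrₗ '' {q | q ∈ Q ∧ p ≤ q} ∈ Φ := by
    refine hgood (s '' (u ∩ Set.Iic i)) _ ⟨p, hp, ⟨i, ⟨hi, Set.self_mem_Iic⟩, hip⟩, ?_, ?_⟩ (hss _ hne)
    · rintro _ ⟨i', hi', rfl⟩
      exact hip ▸ s.monotone hi'.2
    · refine Set.union_subset ?_ Set.subset_union_right
      rintro _ ⟨i', hi', rfl⟩
      rcases le_or_gt i' i with h | h
      · exact Or.inl ⟨i', ⟨hi', h⟩, rfl⟩
      · obtain ⟨q, hq, hpq, h⟩ := hafter i' hi' h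
        exact Or.inr ⟨q, ⟨hq, hpq⟩, h.symm⟩
  obtain ⟨i, -, p, hp, hip, hafter⟩ := exists_last_notMem s Set.univ hbad
  -- A minimal missing chain ends outside `Q`: otherwise cutting it after its last element outside
  -- `Q` gives a proper face, and the invariant puts the tail back.
  obtain rfl : i = Fin.last n := by
    by_contra hne
    refine hmin.notMem (Φ.lower ?_ (htail Set.univ i trivial p hp hip ?_ hafter))
    · rw [Set.image_univ]
      exact Set.subset_union_left
    · intro h
      exact hne (Fin.last_le_iff.1 (Set.eq_univ_iff_forall.1 h (Fin.last n)).2)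
  -- A single vertex would lie in `R`, where the map is already given by `D`.
  obtain _ | n := n
  · refine absurd (hempty _ ?_) hmin.notMem
    rw [Set.eq_empty_iff_forall_notMem]
    rintro a ⟨i, hi⟩
    obtain rfl : i = Fin.last 0 := Fin.ext (by lia)
    exact absurd (hip.symm.trans hi) Sum.inr_ne_inl
  have hmono : StrictMono s := s.monotone.strictMono_of_injective hmin.injective
  have hsle (i) (q : R) (hpq : p ≤ q) : s i ≤ inrₗ q :=
    (hip ▸ s.monotone (Fin.le_last i) : s i ≤ inrₗ p).trans (Sum.Lex.inr_le_inr_iff.2 hpq)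
  let j : Fin (n + 2) ⊕ₗ {q | q ∈ Q ∧ p ≤ q} ↪o Fin (N + 1) ⊕ₗ R :=
    OrderEmbedding.ofMapLEIff
      (sumLexElim s ⟨fun q ↦ inrₗ q.1, fun _ _ h ↦ Sum.Lex.inr_le_inr_iff.2 h⟩
        (fun i q ↦ hsle i q.1 q.2.2)) (by
      intro x y
      induction x using sumLex_cases with
      | hl i =>
        induction y using sumLex_cases with
        | hl i' => exact hmono.le_iff_le.trans Sum.Lex.inl_le_inl_iff.symm
        | hr q => exact iff_of_true (hsle i q.1 q.2.2) (Sum.Lex.inl_le_inr _ _)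
      | hr q =>
        induction y using sumLex_cases with
        | hl i =>
          refine iff_of_false (fun h ↦ ?_) Sum.Lex.not_inr_le_inl
          have h' : q.1 ≤ p := Sum.Lex.inr_le_inr_iff.1 (le_trans h (hsle i p le_rfl))
          exact hp (le_antisymm h' q.2.2 ▸ q.2.1)
        | hr q' =>
          exact (Sum.Lex.inr_le_inr_iff.trans Subtype.coe_le_coe).trans Sum.Lex.inr_le_inr_iff.symm)
  have hjl (i) : j (inlₗ i) = s i := rfl
  have hjr (q : {q | q ∈ Q ∧ p ≤ q}) : j (inrₗ q) = inrₗ q.1 := rfl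
  have hjsub (c : Set (Fin (n + 2) ⊕ₗ {q | q ∈ Q ∧ p ≤ q})) :
      j '' c ⊆ s '' (inlₗ ⁻¹' c) ∪ inrₗ '' {q | q ∈ Q ∧ p ≤ q} := by
    rintro _ ⟨x, hx, rfl⟩
    induction x using sumLex_cases with
    | hl i => exact Or.inl ⟨i, hx, rfl⟩
    | hr q => exact Or.inr ⟨q.1, q.2, rfl⟩
  -- A proper face of `s` either has its `R`-part in `Q`, and the join is covered by `hQ`, or has a
  -- last element `p' ≤ p` outside `Q`, and `htail` applies since `Q_{≥ p} ⊆ Q_{≥ p'}`.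
  have hproper (c : Set (Fin (n + 2) ⊕ₗ {q | q ∈ Q ∧ p ≤ q}))
      (hc : c ∈ joinChains (properSubsets _) {q | q ∈ Q ∧ p ≤ q}) : j '' c ∈ Φ := by
    refine Φ.lower (hjsub c) ?_
    by_cases hcQ : inrₗ ⁻¹' (s '' (inlₗ ⁻¹' c)) ⊆ Q
    · refine hQ _ (U.lower ?_ hs) ?_
      · rintro a (⟨i, -, hi⟩ | ⟨q, -, hq⟩)
        · exact ⟨i, hi⟩
        · exact absurd hq Sum.inr_ne_inl
      · rintro r (h | ⟨q, hq, h⟩)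
        · exact hcQ h
        · exact (Sum.inr_injective h : q = r) ▸ hq.1
    · obtain ⟨i, hi, p', hp', hip', hafter'⟩ := exists_last_notMem s _ hcQ
      have hpp' : p' ≤ p := Sum.Lex.inr_le_inr_iff.1 (hip' ▸ hsle i p le_rfl)
      refine Φ.lower ?_ (htail _ i hi p' hp' hip' ?_ hafter')
      · exact Set.union_subset_union_right _ (Set.image_mono fun q hq ↦ ⟨hq.1, hpp'.trans hq.2⟩)
      · intro h
        exact hc (Set.univ_subset_iff.1 (h ▸ Set.inter_subset_left))
  -- The last vertex of `s` is `p`, so on its join with `Q_{≥ p}` the map is the cone with point `D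
  -- (φ p)`. The limit hypothesis then fills the boundary of `s` joined with `Q_{≥ p}`.
  have hagree : (f.comap j.toOrderHom hproper).Agree
      (conePartialMap D (φ.comp (OrderHom.Subtype.val (· ∈ {q | q ∈ Q ∧ p ≤ q}))) (φ p)
        (fun r ↦ φ.monotone r.2.2) (LowerSet.Iic {Fin.last (n + 1)})) := by
    intro m t ht ht'
    have hcone (x) (hx : ∀ i, x = inlₗ i → i = Fin.last (n + 1)) : coneHom _ φ b hb (j x) =
        coneHom (Fin (n + 2)) (φ.comp (OrderHom.Subtype.val (· ∈ {q | q ∈ Q ∧ p ≤ q})))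
          (φ p) (fun r ↦ φ.monotone r.2.2) x := by
      induction x using sumLex_cases with
      | hl i =>
        obtain rfl := hx i rfl
        rw [hjl, hip]
        rfl
      | hr q => rfl
    have hlast (k : Fin (m.len + 1)) (i) (hk : t k = inlₗ i) : i = Fin.last (n + 1) :=
      ht' (⟨k, hk⟩ : i ∈ inlₗ ⁻¹' Set.range t)
    refine (hf m (j.toOrderHom.comp t) _ ?_).trans (D.val_congr ?_ _)
    · rintro a ⟨k, hk⟩
      change j (t k) = inlₗ a at hk
      generalize hx : t k = x at hk
      induction x using sumLex_cases with
      | hl i =>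
        rw [hlast k i hx, hjl, hip] at hk
        exact absurd hk Sum.inr_ne_inl
      | hr q => exact absurd hk Sum.inr_ne_inl
    · ext k
      exact hcone (t k) (hlast k)
  obtain ⟨g, hg⟩ := hlim p hp n _ hagree
  have hfull (t : Set (Fin (n + 2) ⊕ₗ {q | q ∈ Q ∧ p ≤ q})) (ht : j '' t ∈ Φ) :
      t ∈ joinChains (properSubsets (Fin (n + 2))) {q | q ∈ Q ∧ p ≤ q} := by
    intro h
    refine hmin.notMem (Φ.lower ?_ ht)
    rintro _ ⟨i, rfl⟩
    exact ⟨inlₗ i, (h ▸ Set.mem_univ i : i ∈ inlₗ ⁻¹' t), rfl⟩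
  obtain ⟨k, hkf, -⟩ := PartialNerveMap.exists_glue j f g (by
    intro m t ht ht'
    exact hg m t ht (hfull _ (by rwa [← Set.range_comp])))
  refine ⟨_, k, le_sup_left, hkf, Or.inr ⟨Set.range inlₗ, trivial, ?_⟩, ?_⟩
  · rw [← Set.range_comp]
    rfl
  · rintro c d ⟨p₀, hp₀, hpc, hmax, hd⟩ hc
    have hrel : c ∈ Φ → d ∈ Φ := hgood c d ⟨p₀, hp₀, hpc, hmax, hd⟩
    rcases hc with hc | ⟨c', -, rfl⟩
    · exact Or.inl (hrel hc)
    -- The invariant persists: a new chain contains all of `s`, so its top `p₀` is at least `p`, and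
    -- everything in `Q` above `p₀` is already in the attached join.
    by_cases hc' : inlₗ ⁻¹' c' = Set.univ
    · have hp₁ : inrₗ p ≤ (inrₗ p₀ : Fin (N + 1) ⊕ₗ R) := by
        refine hmax _ ⟨inlₗ (Fin.last (n + 1)), ?_, hip⟩
        exact (hc' ▸ Set.mem_univ _ : Fin.last (n + 1) ∈ inlₗ ⁻¹' c')
      refine Or.inr ⟨j ⁻¹' d, trivial, Set.image_preimage_eq_iff.2 ?_⟩
      intro x hx
      rcases hd hx with ⟨y, -, rfl⟩ | ⟨q, ⟨hq, hpq⟩, rfl⟩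
      · exact ⟨y, rfl⟩
      · exact ⟨inrₗ ⟨q, hq, (Sum.Lex.inr_le_inr_iff.1 hp₁).trans hpq⟩, rfl⟩
    · exact Or.inl (hrel (hproper c' hc'))

end

/-! ### Extension along a retraction by inner horns -/

/-- The sets of vertices of the faces of the `k`-th horn. -/
def hornChains {n : ℕ} (k : Fin (n + 1)) : LowerSet (Set (Fin (n + 1))) where
  carrier := {c | c ∪ {k} ≠ Set.univ}
  lower' _ _ h hc hb := hc (Set.univ_subset_iff.1 (hb ▸ Set.union_subset_union_left _ h))

lemma exists_horn_filler {C : SSet.{v}} [SSet.Quasicategory C] {n : ℕ} {k : Fin (n + 1)}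
    (h0 : 0 < k) (hn : k < Fin.last n) (f : PartialNerveMap (hornChains k) C) :
    ∃ g : PartialNerveMap (⊤ : LowerSet (Set (Fin (n + 1)))) C, g.Agree f := by
  let σ₀ : (Λ[n, k] : SSet.{v}) ⟶ C :=
    { app m := ↾fun x ↦ f.val m.unop (SSet.stdSimplex.asOrderHom x.1) x.2
      naturality m m' a := by
        ext x
        exact (f.map_val a.unop _ _ _).symm }
  obtain ⟨σ, hσ⟩ := SSet.Quasicategory.hornFilling h0 hn σ₀
  refine ⟨⟨fun m s _ ↦ σ.app (op m) (SSet.stdSimplex.objMk s), fun {m m'} a s _ _ ↦ ?_⟩, ?_⟩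
  · exact (ConcreteCategory.congr_hom (σ.naturality a.op) (SSet.stdSimplex.objMk s)).symm
  · intro m s _ hs
    exact (ConcreteCategory.congr_hom (NatTrans.congr_app hσ (op m))
      (⟨SSet.stdSimplex.objMk s, hs⟩ : (Λ[n, k] : SSet.{v}).obj (op m))).symm

variable {E : Type u} [Preorder E] {C : SSet.{v}} {R : Type w} [PartialOrder R]
  {D : PartialNerveMap (⊤ : LowerSet (Set E)) C} {φ : R →o E} {b : E} {hb : ∀ r, b ≤ φ r}

/-- If `R` decomposes into pieces which have least elements, and `Q` is the set of these least
elements, then maps extend along `Q`. -/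
theorem extendsAlong_of_retraction [SSet.Quasicategory C] (Q : Set R) (r : R → R)
    (hrQ : ∀ p, r p ∈ Q) (hQr : ∀ q ∈ Q, r q = q) (hle : ∀ p, r p ≤ p)
    (hconst : ∀ p p', p ≤ p' → r p = r p') :
    ExtendsAlong D φ b hb Q := by
  -- The invariant: an attached chain meeting `R` may be enlarged by the least element `r p` of its
  -- piece.
  refine ExtendsAlong.of_step (fun N c d ↦ ∃ p, inrₗ p ∈ c ∧ d ⊆ insert (inrₗ (r p)) c) ?_ ?_
  · rintro N c d ⟨p, -, hd⟩
    constructor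
    · intro i hi
      exact (hd hi).resolve_left Sum.inl_ne_inr
    · intro hc p' hp'
      rcases hd hp' with h | h
      · exact (Sum.inr_injective h : p' = r p) ▸ hrQ p
      · exact hc h
  intro N U Φ f hempty hQ hf hgood n s hs hmin
  obtain ⟨p, hps, hp⟩ := Set.not_subset.1 fun h ↦ hmin.notMem (hQ _ hs h)
  have hr (p' : R) (hp' : inrₗ p' ∈ Set.range s) : r p' = r p := by
    obtain ⟨i, hi⟩ := hps
    obtain ⟨i', hi'⟩ := hp'
    rcases le_total i i' with h | h
    · have := s.monotone h
      rw [hi, hi'] at this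
      exact (hconst _ _ (Sum.Lex.inr_le_inr_iff.1 this)).symm
    · have := s.monotone h
      rw [hi, hi'] at this
      exact hconst _ _ (Sum.Lex.inr_le_inr_iff.1 this)
  have hface (x) (hx : x ∈ Set.range s) : Set.range s \ {x} ∈ Φ :=
    hmin.mem_of_ssubset _ (Set.sdiff_singleton_ssubset.2 hx)
  -- Otherwise deleting `r p` gives a proper face that still contains `p`, and the invariant
  -- restores `r p`.
  have hq : inrₗ (r p) ∉ Set.range s := by
    intro hq
    refine hmin.notMem (hgood (Set.range s \ {inrₗ (r p)}) _ ⟨p, ⟨hps, ?_⟩, ?_⟩ (hface _ hq))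
    · intro h
      exact hp ((Sum.inr_injective h : p = r p) ▸ hrQ p)
    · rw [Set.insert_sdiff_singleton]
      exact Set.subset_insert _ _
  obtain ⟨k, ⟨p', hp'⟩, hk⟩ : ∃ k, (∃ p', s k = inrₗ p') ∧ ∀ i < k, ∃ a, s i = inlₗ a := by
    obtain ⟨i, hi⟩ := hps
    obtain ⟨k, hk, hkmin⟩ :=
      (Set.toFinite {i | ∃ p', s i = inrₗ p'}).exists_minimal ⟨i, p, hi⟩
    refine ⟨k, hk, fun i hik ↦ ?_⟩
    generalize hx : s i = x
    induction x using sumLex_cases with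
    | hl a => exact ⟨a, rfl⟩
    | hr p' => exact absurd (hkmin ⟨p', hx⟩ hik.le) hik.not_ge
  -- The left part is nonempty, since chains inside `R` are already attached. This keeps the horn
  -- below from being the outer one at `0`.
  have hk0 : 0 < k := by
    by_contra h0
    obtain rfl : k = 0 := Fin.le_zero_iff.1 (not_lt.1 h0)
    refine hmin.notMem (hempty _ ?_)
    rw [Set.eq_empty_iff_forall_notMem]
    rintro a ⟨i, hi⟩
    have := s.monotone (Fin.zero_le i)
    rw [hp', hi] at this
    exact Sum.Lex.not_inr_le_inl this
  have hmono : StrictMono s := s.monotone.strictMono_of_injective hmin.injective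
  -- Inserting `r p` just before the first `R`-vertex of `s` gives a simplex whose face opposite `r
  -- p` is `s`. All other faces are attached already (`hhorn`), so this is an inner horn, and
  -- filling it attaches `s`.
  let t : Fin (n + 2) → Fin (N + 1) ⊕ₗ R := Fin.insertNth k.castSucc (inrₗ (r p)) s
  have ht₁ : t k.castSucc = inrₗ (r p) := Fin.insertNth_apply_same _ _ _
  have ht₂ (i) : t (k.castSucc.succAbove i) = s i := Fin.insertNth_apply_succAbove _ _ _ _
  have htmono : StrictMono t := by
    intro x y hxy
    rcases Fin.eq_self_or_eq_succAbove k.castSucc x with rfl | ⟨i, rfl⟩ <;>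
      rcases Fin.eq_self_or_eq_succAbove k.castSucc y with rfl | ⟨i', rfl⟩
    · exact absurd hxy (lt_irrefl _)
    · rw [ht₁, ht₂]
      have hki : k ≤ i' := Fin.castSucc_le_castSucc_iff.1
        (Fin.lt_succAbove_iff_le_castSucc _ _ |>.1 hxy)
      refine lt_of_le_of_ne ?_ fun h ↦ hq ⟨i', h.symm⟩
      refine le_trans ?_ (s.monotone hki)
      rw [hp', ← hr p' ⟨k, hp'⟩]
      exact Sum.Lex.inr_le_inr_iff.2 (hle p')
    · rw [ht₁, ht₂]
      have hki : i < k := Fin.castSucc_lt_castSucc_iff.1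
        (Fin.succAbove_lt_iff_castSucc_lt _ _ |>.1 hxy)
      obtain ⟨a, ha⟩ := hk i hki
      rw [ha]
      exact Sum.Lex.inl_lt_inr _ _
    · rw [ht₂, ht₂]
      exact hmono (Fin.succAbove_lt_succAbove_iff.1 hxy)
  let j : Fin (n + 2) ↪o Fin (N + 1) ⊕ₗ R := OrderEmbedding.ofStrictMono t htmono
  have hjrange : Set.range j = insert (inrₗ (r p)) (Set.range s) := by
    ext x
    constructor
    · rintro ⟨i, rfl⟩
      rcases Fin.eq_self_or_eq_succAbove k.castSucc i with rfl | ⟨i, rfl⟩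
      · exact Or.inl ht₁
      · exact Or.inr ⟨i, (ht₂ i).symm⟩
    · rintro (rfl | ⟨i, rfl⟩)
      · exact ⟨_, ht₁⟩
      · exact ⟨_, ht₂ i⟩
  have hhorn (c : Set (Fin (n + 2))) (hc : c ∈ hornChains k.castSucc) : j '' c ∈ Φ := by
    obtain ⟨x, hx⟩ := (Set.ne_univ_iff_exists_notMem _).1 hc
    obtain ⟨hxc, hxk⟩ := not_or.1 hx
    obtain ⟨i, rfl⟩ := (Fin.eq_self_or_eq_succAbove k.castSucc x).resolve_left hxk
    have hsub : j '' c ⊆ insert (inrₗ (r p)) (Set.range s \ {s i}) := by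
      rintro _ ⟨y, hy, rfl⟩
      rcases Fin.eq_self_or_eq_succAbove k.castSucc y with rfl | ⟨i', rfl⟩
      · exact Or.inl ht₁
      · refine Or.inr ⟨⟨i', (ht₂ i').symm⟩, fun h ↦ hxc ?_⟩
        have : s i' = s i := (ht₂ i').symm.trans h
        rwa [← hmin.injective this]
    refine Φ.lower hsub ?_
    -- If the face keeps an `R`-vertex of `s`, the invariant adds `r p`; otherwise its only possible
    -- `R`-vertex is `r p ∈ Q`.
    by_cases hex : ∃ p', inrₗ p' ∈ Set.range s \ {s i}
    · obtain ⟨p', hp'⟩ := hex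
      exact hgood _ _ ⟨p', hp', by rw [hr p' hp'.1]⟩ (hface _ ⟨i, rfl⟩)
    · refine hQ _ (U.lower ?_ hs) ?_
      · intro a ha
        exact (ha.resolve_left Sum.inl_ne_inr).1
      · intro p' hp'
        rcases hp' with h | h
        · exact (Sum.inr_injective h : p' = r p) ▸ hrQ p
        · exact absurd ⟨p', h⟩ hex
  obtain ⟨g, hg⟩ := exists_horn_filler (k := k.castSucc) (Fin.castSucc_pos_iff.2 hk0)
    (Fin.castSucc_lt_last k) (f.comap j.toOrderHom hhorn)
  have hfull (c : Set (Fin (n + 2))) (hc : j '' c ∈ Φ) : c ∈ hornChains k.castSucc := by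
    intro h
    refine hmin.notMem (Φ.lower ?_ hc)
    rintro _ ⟨i, rfl⟩
    exact ⟨_, (Set.eq_univ_iff_forall.1 h (k.castSucc.succAbove i)).resolve_right
      (Fin.succAbove_ne _ _), ht₂ i⟩
  obtain ⟨f', hf', -⟩ := PartialNerveMap.exists_glue j f g (by
    intro m t ht ht'
    exact hg m t ht (hfull _ (by rwa [← Set.range_comp])))
  have hsubrange (c) (hc : c ⊆ Set.range j) :
      c ∈ (⊤ : LowerSet (Set (Fin (n + 2)))).imageSets j :=
    ⟨j ⁻¹' c, trivial, Set.image_preimage_eq_iff.2 hc⟩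
  refine ⟨_, f', le_sup_left, hf', Or.inr (hsubrange _ ?_), ?_⟩
  · rw [hjrange]
    exact Set.subset_insert _ _
  · rintro c d ⟨p', hp', hd⟩ (hc | ⟨c', -, rfl⟩)
    · exact Or.inl (hgood c d ⟨p', hp', hd⟩ hc)
    · have hrp' : r p' = r p := by
        have : inrₗ p' ∈ Set.range j := Set.image_subset_range _ _ hp'
        rw [hjrange] at this
        rcases this with h | h
        · rw [(Sum.inr_injective h : p' = r p), hQr _ (hrQ p)]
        · exact hr p' h
      refine Or.inr (hsubrange _ (hd.trans (Set.insert_subset ?_ (Set.image_subset_range _ _))))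
      rw [hjrange, hrp']
      exact Set.mem_insert _ _

/-! ### Comparison of simplicial joins with chains in ordinal sums -/

/-- A monomorphism `ι : A ⟶ Δ[N]` whose image consists of the simplices with vertices in `U`. -/
structure IsSubcomplexOf {A : SSet.{v}} {N : ℕ} (ι : A ⟶ Δ[N]) (U : LowerSet (Set (Fin (N + 1)))) :
    Prop where
  injective : ∀ m, Function.Injective (ι.app m)
  mem_iff : ∀ (m : SimplexCategory) (x : Δ[N].obj (op m)),
    Set.range (SSet.stdSimplex.asOrderHom x) ∈ U ↔ ∃ a, ι.app (op m) a = x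
  empty_mem : ∅ ∈ U

namespace ShapedSimplex

/-- The monotone map with values `l ≤ l'`. -/
def pairHom {L : Type*} [Preorder L] {l l' : L} (h : l ≤ l') : Fin 2 →o L where
  toFun := ![l, l']
  monotone' := by
    intro i j hij
    fin_cases i <;> fin_cases j
    · exact le_rfl
    · exact h
    · exact absurd hij (by decide)
    · exact le_rfl

section

variable {L : Type} [Preorder L] {A : SSet.{v}} {N : ℕ}

lemma asOrderHom_val_apply (ι : A ⟶ Δ[N]) (x : ShapedSimplex A L) (n : SimplexCategory)
    (s : Fin (n.len + 1) →o L) (i : Fin (n.len + 1)) :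
    SSet.stdSimplex.asOrderHom (ι.app (op n) (x.val n s)) i =
      SSet.stdSimplex.asOrderHom (ι.app (op ⦋0⦌) (x.vertex (s i))) 0 := by
  have h := ConcreteCategory.congr_hom (ι.naturality (SimplexCategory.const ⦋0⦌ n i).op)
    (x.val n s)
  have h' : A.map (SimplexCategory.const ⦋0⦌ n i).op (x.val n s) = x.vertex (s i) :=
    x.map_val _ _
  rw [← h']
  exact (congrArg (fun z ↦ SSet.stdSimplex.asOrderHom z 0) h).symm

/-- The vertices of a simplex of shape `L` in a simplicial set over `Δ[N]`. -/
def simplexHom (ι : A ⟶ Δ[N]) (x : ShapedSimplex A L) : L →o Fin (N + 1) where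
  toFun l := SSet.stdSimplex.asOrderHom (ι.app (op ⦋0⦌) (x.vertex l)) 0
  monotone' l l' h := by
    have h₀ := asOrderHom_val_apply ι x ⦋1⦌ (pairHom h)
    refine (h₀ 0).symm.le.trans (le_trans ?_ (h₀ 1).le)
    exact OrderHom.monotone _ (Fin.zero_le _)

variable {ι : A ⟶ Δ[N]} {U : LowerSet (Set (Fin (N + 1)))}

lemma simplexHom_injective (hι : IsSubcomplexOf ι U) :
    Function.Injective (simplexHom (L := L) ι) := by
  intro x y hxy
  ext n s
  refine hι.injective _ (SSet.stdSimplex.objEquiv.injective ?_)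
  refine SimplexCategory.Hom.ext _ _ (OrderHom.ext _ _ (funext fun i ↦ ?_))
  exact ((asOrderHom_val_apply ι x n s i).trans (DFunLike.congr_fun hxy (s i))).trans
    (asOrderHom_val_apply ι y n s i).symm

lemma exists_simplexHom_eq (hι : IsSubcomplexOf ι U) (t : L →o Fin (N + 1))
    (ht : Set.range t ∈ U) : ∃ x : ShapedSimplex A L, simplexHom ι x = t := by
  have key (n : SimplexCategory) (s : Fin (n.len + 1) →o L) :
      ∃ a, ι.app (op n) a = SSet.stdSimplex.objMk (t.comp s) :=
    (hι.mem_iff n _).1 (range_comp_mem ht s)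
  choose a ha using key
  refine ⟨⟨a, fun {m n} g s ↦ hι.injective _ ?_⟩, ?_⟩
  · refine (ConcreteCategory.congr_hom (ι.naturality g.op) (a n s)).trans ?_
    rw [ha]
    exact congrArg (Δ[N].map g.op) (ha n s)
  · ext1
    funext l
    exact congrArg (fun z ↦ SSet.stdSimplex.asOrderHom z 0) (ha ⦋0⦌ (OrderHom.const _ l))

end

section

variable {L : Type} [Preorder L] {P : Type u} [Category.{u} P] {R : Type u} [PartialOrder R]

lemma obj_val_apply (x : ShapedSimplex (nerve'.{u, w} P) L) (n : SimplexCategory)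
    (s : Fin (n.len + 1) →o L) (i : Fin (n.len + 1)) :
    (ULift.down (x.val n s)).obj i = (ULift.down (x.vertex (s i))).obj 0 := by
  have h' : (nerve'.{u, w} P).map (SimplexCategory.const ⦋0⦌ n i).op (x.val n s) =
    x.vertex (s i) := x.map_val _ _
  rw [← h']
  rfl

/-- The vertices of a simplex of shape `L` in the nerve of a category which is isomorphic to a
partial order. -/
def nerveHom (e : R ≃ P) (he : ∀ r r', r ≤ r' ↔ Nonempty (e r ⟶ e r'))
    (x : ShapedSimplex (nerve'.{u, w} P) L) : L →o R where
  toFun l := e.symm ((ULift.down (x.vertex l)).obj 0)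
  monotone' l l' h := by
    have h₀ := obj_val_apply x ⦋1⦌ (pairHom h)
    beta_reduce
    refine (he _ _).2 ⟨eqToHom ?_ ≫ (ULift.down (x.val ⦋1⦌ (pairHom h))).map (homOfLE (Fin.zero_le 1)) ≫
      eqToHom ?_⟩
    · rw [e.apply_symm_apply]
      exact (h₀ 0).symm
    · rw [e.apply_symm_apply]
      exact h₀ 1

variable {e : R ≃ P} {he : ∀ r r', r ≤ r' ↔ Nonempty (e r ⟶ e r')} [Quiver.IsThin P]

lemma nerveHom_injective :
    Function.Injective (nerveHom.{u, w} (L := L) e he) := by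
  intro x y hxy
  ext n s
  refine ULift.down_injective (nerve.ext_of_isThin (n := op n) (funext fun i ↦ ?_))
  rw [obj_val_apply, obj_val_apply]
  exact e.symm.injective (DFunLike.congr_fun hxy (s i))

lemma exists_nerveHom_eq (t : L →o R) :
    ∃ x : ShapedSimplex (nerve'.{u, w} P) L, nerveHom e he x = t := by
  let G (n : SimplexCategory) (s : Fin (n.len + 1) →o L) : ComposableArrows P n.len :=
    { obj i := e (t (s i))
      map f := ((he _ _).1 ((t.comp s).monotone (leOfHom f))).some
      map_id _ := Subsingleton.elim _ _
      map_comp _ _ := Subsingleton.elim _ _ }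
  refine ⟨⟨fun n s ↦ ULift.up (G n s), fun {m n} g s ↦ ?_⟩, ?_⟩
  · exact ULift.down_injective (nerve.ext_of_isThin (n := op m) rfl)
  · ext1
    funext l
    exact e.symm_apply_apply _

end

end ShapedSimplex

namespace JoinSimplex

variable {P : Type u} [Category.{u} P] {R : Type u} [PartialOrder R] {N : ℕ}
  {A : SSet.{max u w}} (ι : A ⟶ Δ[N])
  (e : R ≃ P) (he : ∀ r r', r ≤ r' ↔ Nonempty (e r ⟶ e r'))

/-- The vertices of a simplex of the join of a simplicial set over `Δ[N]` and a nerve. -/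
def toHom {n : SimplexCategory} (x : JoinSimplex A (nerve'.{u, w} P) n) :
    Fin (n.len + 1) →o Fin (N + 1) ⊕ₗ R where
  toFun i := if h : x.cut i = true then inrₗ (x.right.nerveHom e he ⟨i, h⟩)
    else inlₗ (x.left.simplexHom ι ⟨i, Bool.eq_false_of_not_eq_true h⟩)
  monotone' i i' h := by
    by_cases hi : x.cut i = true
    · have hi' : x.cut i' = true := by
        have := x.cut.monotone h
        rw [hi] at this
        exact top_le_iff.1 this
      beta_reduce
      rw [dif_pos hi, dif_pos hi']
      exact Sum.Lex.inr_le_inr_iff.2 (OrderHom.monotone _ h)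
    · beta_reduce
      rw [dif_neg hi]
      split_ifs with hi'
      · exact Sum.Lex.inl_le_inr _ _
      · exact Sum.Lex.inl_le_inl_iff.2 (OrderHom.monotone _ h)

variable {ι e he}

lemma toHom_apply_of_true {n : SimplexCategory} (x : JoinSimplex A (nerve'.{u, w} P) n)
    {i : Fin (n.len + 1)} (h : x.cut i = true) :
    x.toHom ι e he i = inrₗ (x.right.nerveHom e he ⟨i, h⟩) := dif_pos h

lemma toHom_apply_of_false {n : SimplexCategory} (x : JoinSimplex A (nerve'.{u, w} P) n)
    {i : Fin (n.len + 1)} (h : x.cut i = false) :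
    x.toHom ι e he i = inlₗ (x.left.simplexHom ι ⟨i, h⟩) :=
  dif_neg (by rw [h]; exact Bool.false_ne_true)

lemma toHom_map {m n : SimplexCategory} (g : m ⟶ n) (x : JoinSimplex A (nerve'.{u, w} P) n) :
    toHom ι e he ((join A (nerve'.{u, w} P)).map g.op x) =
      (x.toHom ι e he).comp g.toOrderHom := rfl

variable {U : LowerSet (Set (Fin (N + 1)))}

lemma toHom_injective [Quiver.IsThin P] (hι : IsSubcomplexOf ι U) (n : SimplexCategory) :
    Function.Injective (toHom.{u, w} (n := n) ι e he) := by
  rintro x y hxy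
  have hcut : x.cut = y.cut := by
    ext1
    funext i
    have := DFunLike.congr_fun hxy i
    cases hx : x.cut i <;> cases hy : y.cut i
    · rfl
    · rw [toHom_apply_of_false x hx, toHom_apply_of_true y hy] at this
      exact absurd this Sum.inl_ne_inr
    · rw [toHom_apply_of_true x hx, toHom_apply_of_false y hy] at this
      exact absurd this Sum.inr_ne_inl
    · rfl
  obtain ⟨cut, l, r⟩ := x
  obtain ⟨cut', l', r'⟩ := y
  obtain rfl : cut = cut' := hcut
  obtain rfl : l = l' := by
    refine ShapedSimplex.simplexHom_injective hι (OrderHom.ext _ _ (funext fun i ↦ ?_))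
    have := DFunLike.congr_fun hxy i.1
    rw [toHom_apply_of_false _ i.2, toHom_apply_of_false _ i.2] at this
    exact Sum.inl_injective this
  obtain rfl : r = r' := by
    refine ShapedSimplex.nerveHom_injective (e := e) (he := he)
      (OrderHom.ext _ _ (funext fun i ↦ ?_))
    have := DFunLike.congr_fun hxy i.1
    rw [toHom_apply_of_true _ i.2, toHom_apply_of_true _ i.2] at this
    exact Sum.inr_injective this
  rfl

lemma range_toHom_mem (hι : IsSubcomplexOf ι U) {n : SimplexCategory}
    (x : JoinSimplex A (nerve'.{u, w} P) n) : Set.range (x.toHom ι e he) ∈ joinChains U R := by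
  have hsub : inlₗ ⁻¹' Set.range (x.toHom ι e he) ⊆ Set.range (x.left.simplexHom ι) := by
    rintro a ⟨i, hi⟩
    cases h : x.cut i
    · rw [toHom_apply_of_false x h] at hi
      exact ⟨⟨i, h⟩, Sum.inl_injective hi⟩
    · rw [toHom_apply_of_true x h] at hi
      exact absurd hi Sum.inr_ne_inl
  refine U.lower hsub ?_
  obtain h | h := isEmpty_or_nonempty (Part x.cut false)
  · rw [Set.range_eq_empty]
    exact hι.empty_mem
  obtain ⟨l, hl⟩ := Finite.exists_max (fun i : Part x.cut false ↦ i.1)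
  -- Membership in `U` is tested on honest simplices of `A`. Clamping `[n]` at the largest index of
  -- the left part gives one that has all the left vertices.
  let t : Fin (n.len + 1) →o Part x.cut false :=
    { toFun i := ⟨min i l.1, by
        have := x.cut.monotone (min_le_right i l.1)
        rw [l.2] at this
        exact le_bot_iff.1 this⟩
      monotone' i i' h := min_le_min_right _ h }
  refine U.lower ?_ ((hι.mem_iff n _).2 ⟨x.left.val n t, rfl⟩)
  rintro _ ⟨i, rfl⟩
  refine ⟨i.1, (ShapedSimplex.asOrderHom_val_apply ι x.left n t i.1).trans ?_⟩
  have : t i.1 = i := Subtype.ext (min_eq_left (hl i))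
  rw [this]
  rfl

lemma exists_toHom_eq [Quiver.IsThin P] (hι : IsSubcomplexOf ι U) {n : SimplexCategory}
    (s : Fin (n.len + 1) →o Fin (N + 1) ⊕ₗ R) (hs : Set.range s ∈ joinChains U R) :
    ∃ x : JoinSimplex A (nerve'.{u, w} P) n, x.toHom ι e he = s := by
  let κ : Fin (N + 1) ⊕ₗ R →o Bool :=
    sumLexElim (OrderHom.const _ false) (OrderHom.const _ true) (fun _ _ ↦ Bool.false_le _)
  let cut : Fin (n.len + 1) →o Bool := κ.comp s
  have hl (i : Part cut false) : ∃ a, s i.1 = inlₗ a := by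
    obtain ⟨i, hi⟩ := i
    change κ (s i) = false at hi
    change ∃ a, s i = inlₗ a
    generalize s i = x at *
    induction x using sumLex_cases with
    | hl a => exact ⟨a, rfl⟩
    | hr r => exact absurd hi Bool.noConfusion
  have hr (i : Part cut true) : ∃ r, s i.1 = inrₗ r := by
    obtain ⟨i, hi⟩ := i
    change κ (s i) = true at hi
    change ∃ a, s i = inrₗ a
    generalize s i = x at *
    induction x using sumLex_cases with
    | hl a => exact absurd hi Bool.noConfusion
    | hr r => exact ⟨r, rfl⟩
  choose a ha using hl
  choose r hr using hr
  obtain ⟨xl, hxl⟩ := ShapedSimplex.exists_simplexHom_eq hι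
    (⟨a, fun i i' h ↦ by
      have := s.monotone (show i.1 ≤ i'.1 from h)
      rw [ha, ha] at this
      exact Sum.Lex.inl_le_inl_iff.1 this⟩ : Part cut false →o Fin (N + 1))
    (U.lower (by
      rintro _ ⟨i, rfl⟩
      exact ⟨i.1, ha i⟩) hs)
  obtain ⟨xr, hxr⟩ := ShapedSimplex.exists_nerveHom_eq.{u, w} (e := e) (he := he)
    (⟨r, fun i i' h ↦ by
      have := s.monotone (show i.1 ≤ i'.1 from h)
      rw [hr, hr] at this
      exact Sum.Lex.inr_le_inr_iff.1 this⟩ : Part cut true →o R)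
  refine ⟨⟨cut, xl, xr⟩, OrderHom.ext _ _ (funext fun i ↦ ?_)⟩
  cases h : cut i
  · rw [toHom_apply_of_false _ h]
    change inlₗ (xl.simplexHom ι ⟨i, h⟩) = s i
    rw [hxl]
    exact (ha ⟨i, h⟩).symm
  · rw [toHom_apply_of_true _ h]
    change inrₗ (xr.nerveHom e he ⟨i, h⟩) = s i
    rw [hxr]
    exact (hr ⟨i, h⟩).symm

variable {C : SSet.{max u w}}

lemma exists_partialNerveMap [Quiver.IsThin P] (hι : IsSubcomplexOf ι U)
    (q : join A (nerve'.{u, w} P) ⟶ C) :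
    ∃ f : PartialNerveMap (joinChains U R) C,
      ∀ (n : SimplexCategory) (x : JoinSimplex A (nerve'.{u, w} P) n) h,
        f.val n (x.toHom ι e he) h = q.app (op n) x := by
  have key (n : SimplexCategory) (s : Fin (n.len + 1) →o Fin (N + 1) ⊕ₗ R)
      (hs : Set.range s ∈ joinChains U R) :
      ∃ y : C.obj (op n), ∀ x : JoinSimplex A (nerve'.{u, w} P) n, x.toHom ι e he = s →
        y = q.app (op n) x := by
    obtain ⟨x, hx⟩ := exists_toHom_eq (e := e) (he := he) hι s hs
    exact ⟨q.app (op n) x, fun x' hx' ↦ by rw [toHom_injective hι n (hx.trans hx'.symm)]⟩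
  choose y hy using key
  refine ⟨⟨y, fun {m n} g s h h' ↦ ?_⟩, fun n x h ↦ hy n _ h x rfl⟩
  obtain ⟨x, rfl⟩ := exists_toHom_eq (e := e) (he := he) hι s h
  rw [hy n _ h x rfl, hy m _ h' _ (toHom_map g x)]
  exact (ConcreteCategory.congr_hom (q.naturality g.op) x).symm

lemma exists_hom_of_partialNerveMap (hι : IsSubcomplexOf ι U)
    (f : PartialNerveMap (joinChains U R) C) :
    ∃ q : join A (nerve'.{u, w} P) ⟶ C,
      ∀ (n : SimplexCategory) (x : JoinSimplex A (nerve'.{u, w} P) n),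
        q.app (op n) x = f.val n (x.toHom ι e he) (range_toHom_mem hι x) := by
  refine ⟨{ app n := ↾fun x : JoinSimplex A (nerve'.{u, w} P) n.unop ↦
              f.val n.unop (x.toHom ι e he) (range_toHom_mem hι x)
            naturality m n g := ?_ }, fun _ _ ↦ rfl⟩
  ext x
  exact (f.map_val g.unop (x.toHom ι e he) (range_toHom_mem hι x)
    (range_comp_mem (range_toHom_mem hι x) _)).symm

end JoinSimplex

lemma isSubcomplexOf_boundary (n : ℕ) :
    IsSubcomplexOf (∂Δ[n + 1] : SSet.Subcomplex.{v} Δ[n + 1]).ι (properSubsets (Fin (n + 2))) where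
  injective _ _ _ h := Subtype.ext h
  mem_iff m x := by
    have : Set.range (SSet.stdSimplex.asOrderHom x) ∈ properSubsets (Fin (n + 2)) ↔
        x ∈ (∂Δ[n + 1] : SSet.Subcomplex.{v} Δ[n + 1]).obj (op m) :=
      not_congr Set.range_eq_univ
    rw [this]
    exact ⟨fun h ↦ ⟨⟨x, h⟩, rfl⟩, by rintro ⟨a, rfl⟩; exact a.2⟩
  empty_mem h := Set.empty_ne_univ h

lemma isSubcomplexOf_id (N : ℕ) : IsSubcomplexOf (𝟙 (Δ[N] : SSet.{v})) ⊤ where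
  injective _ _ _ h := h
  mem_iff _ x := iff_of_true trivial ⟨x, rfl⟩
  empty_mem := trivial

lemma isSubcomplexOf_boundaryLast (n : ℕ) :
    IsSubcomplexOf (boundaryLast.{v} n ≫ (∂Δ[n + 1] : SSet.Subcomplex.{v} Δ[n + 1]).ι)
      (LowerSet.Iic {Fin.last (n + 1)}) where
  injective m x y _ := by
    refine SSet.stdSimplex.objEquiv.injective (SimplexCategory.Hom.ext _ _ ?_)
    ext1
    funext i
    exact Subsingleton.elim (α := Fin 1) _ _
  mem_iff m x := by
    constructor
    · intro h
      refine ⟨SSet.stdSimplex.objMk (OrderHom.const _ 0), SSet.stdSimplex.objEquiv.injective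
        (SimplexCategory.Hom.ext _ _ ?_)⟩
      ext1
      funext i
      exact (h ⟨i, rfl⟩ : SSet.stdSimplex.asOrderHom x i = Fin.last (n + 1)).symm
    · rintro ⟨a, rfl⟩ _ ⟨i, rfl⟩
      rfl
  empty_mem := Set.empty_subset _

/-- The partial map (defined everywhere) given by a map out of the nerve of a preorder. -/
def nervePartialMap {Q : Type u} [Preorder Q] {C : SSet.{max u w}} (F : nerve'.{u, w} Q ⟶ C) :
    PartialNerveMap (⊤ : LowerSet (Set Q)) C where
  val n s _ := F.app (op n) (ULift.up (s.monotone.functor : ComposableArrows Q n.len))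
  map_val g _ _ _ := (ConcreteCategory.congr_hom (F.naturality g.op) _).symm

section

variable {X : Type u} [Order.Frame X] {C : SSet.{max u w}} {P : Type u} [Category.{u} P]
  {R : Type u} [PartialOrder R]

lemma opensCone_app (F : Presheaf.{u, w} X C) (φ : P ⥤ Xᵒᵈ) (b : X)
    (hb : ∀ k : P, OrderDual.ofDual (φ.obj k) ≤ b) (e : R ≃ P)
    (he : ∀ r r', r ≤ r' ↔ Nonempty (e r ⟶ e r')) (ψ : R →o Xᵒᵈ) (hψ : ∀ r, ψ r = φ.obj (e r))
    (hb' : ∀ r, OrderDual.toDual b ≤ ψ r) {N : ℕ} (ι : Δ[0] ⟶ Δ[N]) (n : SimplexCategory)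
    (x : JoinSimplex Δ[0] (nerve'.{u, w} P) n) :
    (opensCone.{u, w} φ b hb ≫ F).app (op n) x =
      (nervePartialMap F).val n ((coneHom (Fin (N + 1)) ψ (OrderDual.toDual b) hb').comp
        (x.toHom ι e he)) trivial := by
  refine congrArg (F.app (op n)) (ULift.down_injective
    (nerve.ext_of_isThin (n := op n) (funext fun i ↦ ?_)))
  change (if h : x.cut i = true then φ.obj ((ULift.down (x.right.vertex ⟨i, h⟩)).obj 0)
    else OrderDual.toDual b) = coneHom (Fin (N + 1)) ψ (OrderDual.toDual b) hb' (x.toHom ι e he i)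
  by_cases h : x.cut i = true
  · rw [dif_pos h, JoinSimplex.toHom_apply_of_true x h]
    refine Eq.trans ?_ (hψ _).symm
    exact congrArg φ.obj (e.apply_symm_apply _).symm
  · rw [dif_neg h, JoinSimplex.toHom_apply_of_false x (Bool.eq_false_of_not_eq_true h)]
    rfl

/-- Simplices of the joins correspond to chains, so lifting problems and their solutions translate
both ways. The equivalence `e` lets one statement serve both sieves and discrete categories. -/
theorem isLimitCone_opensCone_iff [Quiver.IsThin P] (F : Presheaf.{u, w} X C) (φ : P ⥤ Xᵒᵈ) (b : X)
    (hb : ∀ k : P, OrderDual.ofDual (φ.obj k) ≤ b) (e : R ≃ P)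
    (he : ∀ r r', r ≤ r' ↔ Nonempty (e r ⟶ e r')) (ψ : R →o Xᵒᵈ) (hψ : ∀ r, ψ r = φ.obj (e r))
    (hb' : ∀ r, OrderDual.toDual b ≤ ψ r) :
    IsLimitCone (opensCone.{u, w} φ b hb ≫ F) ↔
      IsLim (nervePartialMap F) ψ (OrderDual.toDual b) hb' := by
  -- The cone is constant on the left summand, so `Δ[0]` may be placed at the last vertex of `Δ[n +
  -- 1]`.
  have happ := fun n ↦ opensCone_app F φ b hb e he ψ hψ hb'
    (boundaryLast n ≫ (∂Δ[n + 1] : SSet.Subcomplex Δ[n + 1]).ι)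
  constructor
  · intro h n f hf
    obtain ⟨f', hf'⟩ := JoinSimplex.exists_hom_of_partialNerveMap (e := e) (he := he)
      (isSubcomplexOf_boundary n) f
    obtain ⟨g', hg'⟩ := h n f' (by
      ext m x
      refine (hf' m.unop ((joinMap _ _).app m x)).trans ((hf m.unop _ _ ?_).trans ?_)
      · exact JoinSimplex.range_toHom_mem (isSubcomplexOf_boundaryLast n) x
      · exact (happ n m.unop x).symm)
    obtain ⟨g, hg⟩ := JoinSimplex.exists_partialNerveMap (e := e) (he := he)
      (isSubcomplexOf_id (n + 1)) g'
    refine ⟨g, fun m s hs hs' ↦ ?_⟩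
    obtain ⟨x, rfl⟩ := JoinSimplex.exists_toHom_eq.{u, w} (e := e) (he := he)
      (isSubcomplexOf_boundary n) s hs'
    refine (hg m ((joinMap (∂Δ[n + 1] : SSet.Subcomplex Δ[n + 1]).ι _).app (op m) x) hs).trans ?_
    exact (ConcreteCategory.congr_hom (NatTrans.congr_app hg' (op m)) x).trans (hf' m x)
  · intro h n f hf
    obtain ⟨f', hf'⟩ := JoinSimplex.exists_partialNerveMap (e := e) (he := he)
      (isSubcomplexOf_boundary n) f
    obtain ⟨g', hg'⟩ := h n f' (by
      intro m s hs hs'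
      obtain ⟨x, rfl⟩ := JoinSimplex.exists_toHom_eq.{u, w} (e := e) (he := he)
        (isSubcomplexOf_boundaryLast n) s hs'
      refine (hf' m ((joinMap (boundaryLast n) _).app (op m) x) hs).trans ?_
      exact (ConcreteCategory.congr_hom (NatTrans.congr_app hf (op m)) x).trans (happ n m x))
    obtain ⟨g, hg⟩ := JoinSimplex.exists_hom_of_partialNerveMap (e := e) (he := he)
      (isSubcomplexOf_id (n + 1)) g'
    refine ⟨g, ?_⟩
    ext m x
    refine (hg m.unop ((joinMap _ _).app m x)).trans ((hg' m.unop _ _ ?_).trans (hf' m.unop x _))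
    exact JoinSimplex.range_toHom_mem (isSubcomplexOf_boundary n) x

end

/-! ### Limits over subsets of a poset -/

section

variable {E : Type u} [PartialOrder E] {C : SSet.{v}}

/-- The condition that `D b` is the limit of the restriction of `D` to a set. -/
def IsLimOn (D : PartialNerveMap (⊤ : LowerSet (Set E)) C) (A : Set E) (b : E)
    (hb : ∀ x ∈ A, b ≤ x) : Prop :=
  IsLim D (OrderHom.Subtype.val (· ∈ A)) b (fun x ↦ hb x.1 x.2)

variable {D : PartialNerveMap (⊤ : LowerSet (Set E)) C}

lemma IsLimOn.congr {A A' : Set E} {b b' : E} {hb : ∀ x ∈ A, b ≤ x} (h : IsLimOn D A b hb)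
    (hA : A = A') (hbb' : b = b') (hb' : ∀ x ∈ A', b' ≤ x) : IsLimOn D A' b' hb' := by
  subst hA hbb'
  exact h

lemma isLim_iff_isLimOn {R : Type*} [PartialOrder R] {φ : R →o E} {b : E} {hb : ∀ r, b ≤ φ r}
    {A : Set E} {hA : ∀ x ∈ A, b ≤ x} (e : R ≃o A) (he : ∀ r, (e r).1 = φ r) :
    IsLim D φ b hb ↔ IsLimOn D A b hA :=
  ⟨fun h ↦ h.of_orderIso e _ he _, fun h ↦ h.of_orderIso e.symm φ (fun x ↦ by
    rw [← he, e.apply_symm_apply]; rfl) _⟩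

lemma isLim_iff_isLimOn_empty {R : Type*} [PartialOrder R] [IsEmpty R] {φ : R →o E} {b b' : E}
    {hb : ∀ r, b ≤ φ r} {A : Set E} {hA : ∀ x ∈ A, b' ≤ x} (hAe : A = ∅) (h : b = b') :
    IsLim D φ b hb ↔ IsLimOn D A b' hA := by
  subst h hAe
  exact isLim_iff_isLimOn ⟨Equiv.equivOfIsEmpty _ _, fun {r} ↦ isEmptyElim r⟩ isEmptyElim

/-- The order isomorphism between a subset of `A` and the corresponding subset of `E`. -/
def subtypeSubtypeIso {A B : Set E} (hBA : B ⊆ A) : {x | (x : A).1 ∈ B} ≃o B where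
  toFun x := ⟨x.1.1, x.2⟩
  invFun x := ⟨⟨x.1, hBA x.2⟩, x.2⟩
  left_inv _ := rfl
  right_inv _ := rfl
  map_rel_iff' := Iff.rfl

lemma isLimOn_iff_of_extendsAlong {A B : Set E} (hBA : B ⊆ A) {b : E} {hb : ∀ x ∈ A, b ≤ x}
    (h : ExtendsAlong D (OrderHom.Subtype.val (· ∈ A)) b (fun x ↦ hb x.1 x.2) {x | x.1 ∈ B}) :
    IsLimOn D A b hb ↔ IsLimOn D B b (fun x hx ↦ hb x (hBA hx)) :=
  h.isLim_iff.trans (isLim_iff_isLimOn (subtypeSubtypeIso hBA) (fun _ ↦ rfl))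

/-- If `D p` is the limit of `D` over the elements of `B` above `p` for all `p` in `A`, then limits
over `A` are limits over `B`. -/
theorem isLimOn_iff_of_forall_isLimOn {A B : Set E} (hBA : B ⊆ A) {b : E} {hb : ∀ x ∈ A, b ≤ x}
    (h : ∀ p ∈ A, p ∉ B → IsLimOn D {x | x ∈ B ∧ p ≤ x} p (fun _ hx ↦ hx.2)) :
    IsLimOn D A b hb ↔ IsLimOn D B b (fun x hx ↦ hb x (hBA hx)) := by
  refine isLimOn_iff_of_extendsAlong hBA (extendsAlong_of_isLim _ fun p hp ↦ ?_)
  refine (isLim_iff_isLimOn (subtypeSubtypeIso (B := {x | x ∈ B ∧ p.1 ≤ x})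
    fun x hx ↦ hBA hx.1) (fun _ ↦ rfl)).2 (h p.1 p.2 hp)

/-- If every element of `A` lies above a unique element of `B`, then limits over `A` are limits
over `B`. -/
theorem isLimOn_iff_of_retraction [SSet.Quasicategory C] {A B : Set E} (hBA : B ⊆ A) {b : E}
    {hb : ∀ x ∈ A, b ≤ x} (r : E → E) (hrB : ∀ p ∈ A, r p ∈ B) (hBr : ∀ q ∈ B, r q = q)
    (hle : ∀ p ∈ A, r p ≤ p) (hconst : ∀ p ∈ A, ∀ p' ∈ A, p ≤ p' → r p = r p') :
    IsLimOn D A b hb ↔ IsLimOn D B b (fun x hx ↦ hb x (hBA hx)) := by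
  refine isLimOn_iff_of_extendsAlong hBA (extendsAlong_of_retraction _
    (fun p ↦ ⟨r p.1, hBA (hrB p.1 p.2)⟩) (fun p ↦ hrB p.1 p.2) (fun q hq ↦ Subtype.ext (hBr q.1 hq))
    (fun p ↦ hle p.1 p.2) (fun p p' h ↦ Subtype.ext (hconst p.1 p.2 p'.1 p'.2 h)))

end

/-! ### Disjoint families and the sieves they generate -/

/-- A type with the discrete order. -/
def DiscreteOrder (I : Type u) : Type u := I

instance (I : Type u) : PartialOrder (DiscreteOrder I) where
  le i j := i = j
  le_refl _ := rfl
  le_trans _ _ _ := Eq.trans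
  le_antisymm _ _ h _ := h

section

variable {X : Type u} [Order.Frame X]

/-- A family of opens as a monotone map from a discrete order. -/
def familyHom {I : Type u} (a : I → X) : DiscreteOrder I →o Xᵒᵈ where
  toFun i := OrderDual.toDual (a i)
  monotone' i j h := by
    obtain rfl : i = j := h
    exact le_rfl

lemma toDual_iSup_le_familyHom {I : Type u} (a : I → X) (i : DiscreteOrder I) :
    OrderDual.toDual (⨆ i, a i) ≤ familyHom a i :=
  OrderDual.toDual_le_toDual.2 (le_iSup a i)

/-- The opens which are contained in a member of a family, as a subset of the order dual. -/
def generatedSieve {I : Type u} (a : I → X) : Set Xᵒᵈ := {V | ∃ i, OrderDual.ofDual V ≤ a i}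

lemma toDual_iSup_le_of_mem_generatedSieve {I : Type u} (a : I → X) (V : Xᵒᵈ)
    (hV : V ∈ generatedSieve a) : OrderDual.toDual (⨆ i, a i) ≤ V := by
  obtain ⟨i, hi⟩ := hV
  exact OrderDual.toDual_le.2 (hi.trans (le_iSup a i))

section

variable {C : SSet.{v}} {D : PartialNerveMap (⊤ : LowerSet (Set Xᵒᵈ)) C}

/-- The index is changed in three moves: discard the indices with `a i = ⊥`, pass from the remaining
`a i` to all nonzero opens below them, then add `⊥`. The first and last use that `D ⊥` is final, and
the middle one uses the retraction onto the unique `a i` containing a nonzero open. -/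
theorem isLim_familyHom_iff [SSet.Quasicategory C]
    (hD : IsLimOn D ∅ (OrderDual.toDual ⊥) (fun _ h ↦ h.elim)) {I : Type u} (a : I → X)
    (ha : IsDisjointFamily a) :
    IsLim D (familyHom a) (OrderDual.toDual (⨆ i, a i)) (toDual_iSup_le_familyHom a) ↔
      IsLimOn D (generatedSieve a) (OrderDual.toDual (⨆ i, a i))
        (toDual_iSup_le_of_mem_generatedSieve a) := by
  classical
  have huniq (V : X) (hV : V ≠ ⊥) (i j : I) (hi : V ≤ a i) (hj : V ≤ a j) : i = j := by
    by_contra hij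
    exact hV (le_bot_iff.1 ((le_inf hi hj).trans (ha i j hij).le))
  let Q : Set (DiscreteOrder I) := {i | a i ≠ ⊥}
  have hext : ExtendsAlong D (familyHom a) (OrderDual.toDual (⨆ i, a i))
      (toDual_iSup_le_familyHom a) {i | a i ≠ ⊥} := by
    refine extendsAlong_of_isLim _ fun p hp ↦ ?_
    have hp' : a p = ⊥ := not_not.1 hp
    have : IsEmpty (Subtype (· ∈ {q | q ∈ Q ∧ p ≤ q})) :=
      ⟨fun q ↦ hp ((q.2.2 : p = q.1) ▸ q.2.1)⟩
    exact (isLim_iff_isLimOn_empty rfl (congrArg OrderDual.toDual hp')).2 hD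
  -- Nonzero disjoint members are pairwise incomparable, so the discrete order on the index is the
  -- order induced from the opens.
  let ψ : Q ↪o Xᵒᵈ :=
    OrderEmbedding.ofMapLEIff (fun i ↦ familyHom a i.1) (fun i j ↦
      ⟨fun h ↦ huniq (a j.1) j.2 i.1 j.1 (OrderDual.toDual_le_toDual.1 h) le_rfl,
        fun h ↦ (familyHom a).monotone h⟩)
  let A : Set Xᵒᵈ := {V | OrderDual.ofDual V ≠ ⊥ ∧ V ∈ generatedSieve a}
  have hψA : Set.range ψ ⊆ A := by
    rintro _ ⟨i, rfl⟩
    exact ⟨i.2, i.1, le_rfl⟩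
  have hAS : A ⊆ generatedSieve a := fun _ h ↦ h.2
  have h₁ : IsLim D (familyHom a) (OrderDual.toDual (⨆ i, a i)) (toDual_iSup_le_familyHom a) ↔
      IsLimOn D (Set.range ψ) (OrderDual.toDual (⨆ i, a i))
        (fun V hV ↦ toDual_iSup_le_of_mem_generatedSieve a V (hAS (hψA hV))) :=
    hext.isLim_iff.trans (isLim_iff_isLimOn ψ.orderIso (fun _ ↦ rfl))
  let r : Xᵒᵈ → Xᵒᵈ := fun V ↦
    if h : ∃ i, OrderDual.ofDual V ≤ a i then OrderDual.toDual (a h.choose) else V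
  have hr (V : Xᵒᵈ) (hV : OrderDual.ofDual V ≠ ⊥) (i : I) (hi : OrderDual.ofDual V ≤ a i) :
      r V = OrderDual.toDual (a i) := by
    have h : ∃ i, OrderDual.ofDual V ≤ a i := ⟨i, hi⟩
    have hc : h.choose = i := huniq _ hV _ _ h.choose_spec hi
    simp only [r, dif_pos h, hc]
  have h₂ := isLimOn_iff_of_retraction (D := D) hψA
    (hb := fun V hV ↦ toDual_iSup_le_of_mem_generatedSieve a V (hAS hV)) r (by
      rintro V ⟨hV, i, hi⟩
      rw [hr V hV i hi]
      exact ⟨⟨i, fun h ↦ hV (le_bot_iff.1 (h ▸ hi))⟩, rfl⟩) (by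
      rintro _ ⟨i, rfl⟩
      exact hr _ i.2 i.1 le_rfl) (by
      rintro V ⟨hV, i, hi⟩
      rw [hr V hV i hi]
      exact hi) (by
      rintro V ⟨hV, i, hi⟩ W ⟨hW, -⟩ hVW
      rw [hr V hV i hi, hr W hW i (le_trans hVW hi)])
  have h₃ := isLimOn_iff_of_forall_isLimOn (D := D) hAS
    (hb := toDual_iSup_le_of_mem_generatedSieve a) (by
      intro p hp hpA
      have hp' : OrderDual.ofDual p = ⊥ := by
        by_contra h
        exact hpA ⟨h, hp⟩
      refine hD.congr (Set.eq_empty_iff_forall_notMem.2 ?_).symm (congrArg OrderDual.toDual hp').symm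
        _
      rintro V ⟨⟨hV, -⟩, hpV⟩
      exact hV (le_bot_iff.1 (hp' ▸ (hpV : OrderDual.ofDual V ≤ OrderDual.ofDual p))))
  exact h₁.trans (h₂.symm.trans h₃.symm)

end

/-- Take a maximal disjoint subset of `S`. If `V ∈ S` and `W` is the complement of its join, then `V
⊓ W` can be added, hence already belongs to it. So `V ⊓ W` lies below both the join and `W`, and
vanishes. -/
lemma exists_pairwiseDisjoint_sSup_eq [ComplementedLattice X] (S : LowerSet X) {U : X}
    (hS : IsLUB (S : Set X) U) :
    ∃ A : Set X, A ⊆ S ∧ A.PairwiseDisjoint id ∧ sSup A = U := by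
  obtain ⟨A, hA⟩ := zorn_subset {A | A ⊆ (S : Set X) ∧ A.PairwiseDisjoint id} (by
    intro c hc hchain
    refine ⟨⋃₀ c, ⟨Set.sUnion_subset fun A hA ↦ (hc hA).1, ?_⟩, fun A hA ↦
      Set.subset_sUnion_of_mem hA⟩
    exact (Set.pairwiseDisjoint_sUnion hchain.directedOn).2 fun A hA ↦ (hc hA).2)
  refine ⟨A, hA.prop.1, hA.prop.2, le_antisymm (sSup_le fun V hV ↦ hS.1 (hA.prop.1 hV)) ?_⟩
  refine hS.2 fun V hV ↦ ?_
  obtain ⟨W, hW⟩ := exists_isCompl (sSup A)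
  have hVW : V ⊓ W ∈ A := by
    refine hA.le_of_ge ⟨Set.insert_subset (S.lower inf_le_left hV) hA.prop.1, ?_⟩
      (Set.subset_insert (V ⊓ W) A) (Set.mem_insert _ _)
    refine hA.prop.2.insert fun B hB _ ↦ ?_
    exact (hW.disjoint.mono (le_sSup hB) inf_le_right).symm
  have hdisj : Disjoint V W := by
    rw [disjoint_iff_inf_le]
    exact hW.disjoint (le_sSup hVW) inf_le_right
  exact hdisj.le_of_codisjoint hW.codisjoint.symm

/-! ### The two implications -/

variable {C : SSet.{max u w}}

lemma isSheaf_iff (F : Presheaf.{u, w} X C) :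
    IsSheaf F ↔ ∀ (U : X) (S : LowerSet X) (hS : IsLUB (S : Set X) U),
      IsLimOn (nervePartialMap F) (OrderDual.ofDual ⁻¹' (S : Set X)) (OrderDual.toDual U)
        (fun _ hV ↦ hS.1 hV) := by
  refine forall₃_congr fun U S hS ↦ ?_
  exact isLimitCone_opensCone_iff F (sieveInclusion S) U _
    (R := (OrderDual.ofDual ⁻¹' (S : Set X) : Set Xᵒᵈ))
    ⟨fun V ↦ OrderDual.toDual ⟨OrderDual.ofDual V.1, V.2⟩,
      fun V ↦ ⟨OrderDual.toDual (OrderDual.ofDual V).1, (OrderDual.ofDual V).2⟩,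
      fun _ ↦ rfl, fun _ ↦ rfl⟩
    (fun V W ↦ ⟨fun h ↦ ⟨homOfLE h⟩, fun ⟨f⟩ ↦ leOfHom f⟩) _ (fun _ ↦ rfl) _

lemma carriesDisjointJoinsToProducts_iff (F : Presheaf.{u, w} X C) :
    CarriesDisjointJoinsToProducts F ↔ ∀ (I : Type u) (a : I → X), IsDisjointFamily a →
      IsLim (nervePartialMap F) (familyHom a) (OrderDual.toDual (⨆ i, a i))
        (toDual_iSup_le_familyHom a) := by
  refine forall₃_congr fun I a _ ↦ ?_
  exact isLimitCone_opensCone_iff F _ _ _ (R := DiscreteOrder I) discreteEquiv.symm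
    (fun i j ↦ ⟨fun h ↦ ⟨eqToHom (congrArg _ h)⟩, fun ⟨f⟩ ↦ Discrete.eq_of_hom f⟩) _
    (fun _ ↦ rfl) _

theorem IsSheaf.carriesDisjointJoinsToProducts [SSet.Quasicategory C] {F : Presheaf.{u, w} X C}
    (hF : IsSheaf F) : CarriesDisjointJoinsToProducts F := by
  rw [isSheaf_iff] at hF
  rw [carriesDisjointJoinsToProducts_iff]
  intro I a ha
  -- The empty sieve covers `⊥`, so `F ⊥` is final.
  have hbot := hF ⊥ ⊥ (by simp)
  rw [isLim_familyHom_iff (hbot.congr rfl rfl _) a ha]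
  exact hF (⨆ i, a i) ⟨{V | ∃ i, V ≤ a i}, fun V W h ⟨i, hi⟩ ↦ ⟨i, h.trans hi⟩⟩
    ⟨fun V ⟨i, hi⟩ ↦ hi.trans (le_iSup a i), fun W hW ↦ iSup_le fun i ↦ hW ⟨i, le_rfl⟩⟩

theorem CarriesDisjointJoinsToProducts.isSheaf [ComplementedLattice X] [SSet.Quasicategory C]
    {F : Presheaf.{u, w} X C} (hF : CarriesDisjointJoinsToProducts F) : IsSheaf F := by
  rw [carriesDisjointJoinsToProducts_iff] at hF
  rw [isSheaf_iff]
  intro U S hS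
  have : IsEmpty (DiscreteOrder PEmpty.{u + 1}) := inferInstanceAs (IsEmpty PEmpty)
  have hbot : IsLimOn (nervePartialMap F) ∅ (OrderDual.toDual ⊥) (fun _ h ↦ h.elim) :=
    -- Finality of `F ⊥` is the product condition for the empty family.
    (isLim_iff_isLimOn_empty rfl (congrArg OrderDual.toDual (iSup_of_empty _))).1
      (hF PEmpty PEmpty.elim (fun i ↦ i.elim))
  have hlim {I : Type u} (a : I → X) (ha : IsDisjointFamily a) :=
    (isLim_familyHom_iff hbot a ha).1 (hF I a ha)
  obtain ⟨A, hAS, hA, rfl⟩ := exists_pairwiseDisjoint_sSup_eq S hS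
  let a : A → X := Subtype.val
  have ha : IsDisjointFamily a := fun i j hij ↦
    (hA i.2 j.2 (fun h ↦ hij (Subtype.ext h))).eq_bot
  have hsup : ⨆ i, a i = sSup A := (sSup_eq_iSup' A).symm
  have hsub : generatedSieve a ⊆ OrderDual.ofDual ⁻¹' (S : Set X) :=
    fun V ⟨i, hi⟩ ↦ S.lower hi (hAS i.2)
  -- It remains to see that `F p` is the limit over the part of the generated sieve below `p`. That
  -- part is generated by the disjoint opens `a i ⊓ p`, whose join is `p` by the frame distributive
  -- law and `p ≤ sSup A`.
  refine (isLimOn_iff_of_forall_isLimOn hsub ?_).2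
    ((hlim a ha).congr rfl (congrArg OrderDual.toDual hsup) _)
  intro p hp _
  refine (hlim (fun i ↦ a i ⊓ OrderDual.ofDual p) fun i j hij ↦ ?_).congr ?_ ?_ _
  · exact le_bot_iff.1 ((inf_le_inf inf_le_left inf_le_left).trans (ha i j hij).le)
  · ext V
    constructor
    · rintro ⟨i, hi⟩
      exact ⟨⟨i, hi.trans inf_le_left⟩, (hi.trans inf_le_right : OrderDual.ofDual V ≤ _)⟩
    · rintro ⟨⟨i, hi⟩, hV⟩
      exact ⟨i, le_inf hi hV⟩
  · rw [← iSup_inf_eq, hsup]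
    exact congrArg OrderDual.toDual (inf_eq_right.2 (hS.1 hp))

end

end InftySheaf

theorem mainTheorem7 {X : Type u} [Order.Frame X] [ComplementedLattice X]
    (C : SSet.{max u w}) [SSet.Quasicategory C] (hC : InftySheaf.HasSmallLimits.{u, w} C)
    (F : InftySheaf.Presheaf.{u, w} X C) :
    InftySheaf.IsSheaf.{u, w} F ↔ InftySheaf.CarriesDisjointJoinsToProducts.{u, w} F :=
  ⟨fun h ↦ h.carriesDisjointJoinsToProducts, fun h ↦ h.isSheaf⟩
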